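/- Let $\mathbf k$ be an infinite field, $n\ge 0$ an integer and $P$ a partition of $n$. Write $S_P$ for the set of integers occurring as parts of $P$, $n_i$ for the multiplicity of $i$ in $P$, and let $r_P$ be the minimum number of subpartitions $P_1,\dots,P_r$ in a decomposition $P=P_1\cup\dots\cup P_r$ in which the parts of each $P_j$ differ pairwise by at most one. *The commutator.* Let $V$ be the $\mathbf k$-vector space with basis the vertices $(u,i,k)$, $i\in S_P$, $1\le u\le i$, $1\le k\le n_i$, of Oblak's poset $\mathcal D_P$, and let $B=J_P$ be the nilpotent Jordan matrix with $B(u,i,k)=(u+1,i,k)$ for $u<i$ and $B(i,i,k)=0$. Let $\mathcal N_B$ be the set of nilpotent matrices over $\mathbf k$ commuting with $B$, and $\mathcal U_B$ the set of matrices $A$ commuting with $B$ such that for all $i\in S_P$ and $1\le k'\le k\le n_i$ the coefficient of $A(1,i,k)$ on $(1,i,k')$ is $0$. The Jordan type $P_A$ of a nilpotent matrix $A$ is the partition of $n$ for which $A$ is conjugate to $J_{P_A}$. The generic Jordan type $Q(P)$ is the partition such that $P_A=Q(P)$ for all $A$ in some Zariski open dense subset of $\mathcal N_B$. *Dominance.*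 For sequences of parts, $Q\ge\lambda$ means $\sum_{j\le i}Q_j\ge\sum_{j\le i}\lambda_j$ for all $i$ (sequences being continued by zeros). *The partition $\lambda_U(\mathcal D_P)$.* For integers $a_1,\dots,a_s\in S_P$ with $a_i\ge a_{i+1}+2$ for $1\le i<s$, put $\mathfrak A=(a_1,\dots,a_s)$ and let the $s$-$U$-chain $U_{\mathfrak A}$ consist of all vertices $(u,\ell,k)$ such that either $\ell\in\{a_1,a_1-1,\dots,a_s,a_s-1\}$, or $u\le \#\{j: a_j<\ell\}$, or $u\ge \ell+1-\#\{j: a_j<\ell\}$. Let $u_s$ be the maximum number of vertices of an $s$-$U$-chain, $u_0=0$. Then $\lambda_U(\mathcal D_P)$ has the parts $u_i-u_{i-1}$, $1\le i\le r_P$. *Adequate matrices.* For $i\in S_P$, $i\neq\min S_P$, let $i^-=\max\{s\in S_P: s<i\}$. Define endomorphisms of $V$, zero on the basis vectors not listed: $\beta_i:(u,i,n_i)\mapsto(u,i^-,1)$ and $\alpha_i:(u,i^-,n_{i^-})\mapsto(u+i-i^-,i,1)$ for $1\le u\le i^-$; $e_{i,k}:(u,i,k)\mapsto(u,i,k+1)$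 for $1\le u\le i$, $1\le k<n_i$; $w_\ell:(u,\ell,n_\ell)\mapsto(u+1,\ell,1)$ for $1\le u<\ell$. Let $S_P''$ be the set of minima of those maximal sets of consecutive integers in $S_P$ that have odd cardinality. A matrix $A\in\mathcal U_B$ is adequate if $$A=\sum_{i\in S_P,\ i\ne\min S_P}(s_i\beta_i+t_i\alpha_i)+\sum_{i\in S_P,\ 1\le k<n_i}t_{i,k}e_{i,k}+\sum_{\ell\in S_P''}z_\ell w_\ell$$ with all the coefficients $s_i,t_i,t_{i,k},z_\ell\in\mathbf k$ non-zero. **Theorem 3.9.** The generic Jordan type $Q(P)$ exists, is unique, and satisfies $Q(P)\ge\lambda_U(\mathcal D_P)$. Moreover there is an adequate $A\in\mathcal U_B$ over $\mathbf k$ whose Jordan type satisfies $P_A\ge\lambda_U(\mathcal D_P)$. -/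

import Mathlib

namespace Oblak

/-! ### Partitions and dominance -/

/-- The multiplicity `n_i` of `i` as a part of `P`. -/
def mult {n : ℕ} (P : n.Partition) (i : ℕ) : ℕ := P.parts.count i

/-- The set `S_P` of integers that occur as parts of `P`. -/
def supp {n : ℕ} (P : n.Partition) : Finset ℕ := P.parts.toFinset

/-- The parts of `Q` in non-increasing order, indexed from `0` and continued by zeros. -/
def partSeq {n : ℕ} (Q : n.Partition) (i : ℕ) : ℤ :=
  (((Q.parts.sort (· ≥ ·)).getD i 0 : ℕ) : ℤ)

/-- Dominance order on sequences of parts (indexed from `0`):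
every partial sum of `p` is at least the corresponding partial sum of `q`. -/
def Dominates (p q : ℕ → ℤ) : Prop :=
  ∀ i : ℕ, ∑ j ∈ Finset.range i, q j ≤ ∑ j ∈ Finset.range i, p j

/-- A multiset of parts is almost rectangular if any two of its members differ by at most one. -/
def AlmostRectangular (m : Multiset ℕ) : Prop := ∀ a ∈ m, ∀ b ∈ m, a ≤ b + 1

/-- `r_P`: the minimum number of almost rectangular subpartitions whose union is `P`. -/
noncomputable def rNum {n : ℕ} (P : n.Partition) : ℕ :=
  sInf {r : ℕ | ∃ f : Fin r → Multiset ℕ,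
    (∑ j, f j) = P.parts ∧ ∀ j, AlmostRectangular (f j)}

/-! ### The vertices `(u, i, k)` -/

/-- The vertices `(u, i, k)` of `D_P`, with `i ∈ S_P`, `1 ≤ u ≤ i` and `1 ≤ k ≤ n_i`. -/
def vertices {n : ℕ} (P : n.Partition) : Finset (ℕ × ℕ × ℕ) :=
  (supp P).biUnion fun i => Finset.Icc 1 i ×ˢ ({i} ×ˢ Finset.Icc 1 (mult P i))

/-- The vertices of `D_P` as a type; it indexes the basis `(u, i, k)` of the vector space. -/
abbrev Vertex {n : ℕ} (P : n.Partition) : Type := {v : ℕ × ℕ × ℕ // v ∈ vertices P}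

namespace Vertex

variable {n : ℕ} {P : n.Partition}

/-- The position `u` of `(u, i, k)` in its row. -/
def pos (v : Vertex P) : ℕ := v.1.1

/-- The level `i` of `(u, i, k)`, that is, the length of its row. -/
def level (v : Vertex P) : ℕ := v.1.2.1

/-- The index `k` of the row of `(u, i, k)` among the rows of length `i`. -/
def row (v : Vertex P) : ℕ := v.1.2.2

end Vertex

/-! ### `U`-chains and the partition `λ_U(D_P)` -/

/-- The labels `𝔄 = (a_1, …, a_s)` of the `s`-`U`-chains: all `a_i` are in `S_P` and
`a_i ≥ a_{i+1} + 2`. Such a decreasing tuple is recorded as the set of its entries. -/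
def labels {n : ℕ} (P : n.Partition) (s : ℕ) : Finset (Finset ℕ) :=
  ((supp P).powersetCard s).filter fun A => ∀ a ∈ A, ∀ b ∈ A, a < b → a + 2 ≤ b

/-- The vertices of the `s`-`U`-chain `U_𝔄`: all vertices at the levels `a, a - 1` for `a ∈ 𝔄`,
and, at each other level `ℓ`, the first and the last `#{a ∈ 𝔄 | a < ℓ}` vertices of every row
(none if no element of `𝔄` is smaller than `ℓ`). -/
def uChain {n : ℕ} (P : n.Partition) (A : Finset ℕ) : Finset (Vertex P) :=
  Finset.univ.filter fun v =>
    (v.level ∈ A ∨ v.level + 1 ∈ A) ∨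
      (v.pos ≤ (A.filter fun a => a < v.level).card ∨
        v.level + 1 ≤ v.pos + (A.filter fun a => a < v.level).card)

/-- `u_s(D_P)`: the maximum number of vertices of an `s`-`U`-chain (`0` for `s = 0`). -/
def uMax {n : ℕ} (P : n.Partition) (s : ℕ) : ℕ :=
  (labels P s).sup fun A => (uChain P A).card

/-- The parts `u_{i+1} - u_i`, `0 ≤ i < r_P`, of `λ_U(D_P)`, indexed from `0` and continued
by zeros. -/
noncomputable def lambdaU {n : ℕ} (P : n.Partition) (i : ℕ) : ℤ :=
  if i < rNum P then (uMax P (i + 1) : ℤ) - (uMax P i : ℤ) else 0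

/-! ### Jordan matrices and Jordan types

Matrices act on column vectors: `M w v` is the coefficient of `M v` on the basis vector `w`. -/

/-- The nilpotent Jordan matrix `J_P`: it sends `(u, i, k)` to `(u + 1, i, k)` if `u < i`
and to `0` if `u = i`. -/
def jordanMatrix (K : Type*) [Field K] {n : ℕ} (P : n.Partition) :
    Matrix (Vertex P) (Vertex P) K :=
  Matrix.of fun w v =>
    if w.pos = v.pos + 1 ∧ w.level = v.level ∧ w.row = v.row then 1 else 0

/-- `A` has Jordan type `Q`: in a suitable basis the endomorphism `A` has the matrix `J_Q`. -/
def HasJordanType {K : Type*} [Field K] {n : ℕ} {P : n.Partition}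
    (A : Matrix (Vertex P) (Vertex P) K) (Q : n.Partition) : Prop :=
  ∃ e : (Vertex P → K) ≃ₗ[K] (Vertex Q → K),
    ∀ x : Vertex P → K, e (A.mulVec x) = (jordanMatrix K Q).mulVec (e x)

/-! ### The nilpotent commutator and its generic Jordan type -/

/-- The nilpotent commutator `N_B` of `B = J_P`. -/
def nilCommutator (K : Type*) [Field K] {n : ℕ} (P : n.Partition) :
    Set (Matrix (Vertex P) (Vertex P) K) :=
  {A | Commute A (jordanMatrix K P) ∧ IsNilpotent A}

/-- A set of matrices as a subset of affine space, whose coordinates are the entries. -/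
def asPoints {K : Type*} {V : Type*} (X : Set (Matrix V V K)) : Set (V × V → K) :=
  {x | Matrix.of (fun w v => x (w, v)) ∈ X}

/-- `D` is a Zariski open and dense subset of `X`. -/
def IsZariskiOpenDense {K : Type*} [Field K] {V : Type*} (X D : Set (Matrix V V K)) : Prop :=
  (∃ I : Ideal (MvPolynomial (V × V) K),
    asPoints D = asPoints X \ MvPolynomial.zeroLocus K I) ∧
  asPoints X ⊆ MvPolynomial.zeroLocus K (MvPolynomial.vanishingIdeal K (asPoints D))

/-- `Q` is the generic Jordan type of the nilpotent commutator of `J_P`: all matrices in some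
Zariski open dense subset of it have Jordan type `Q`. -/
def IsGenericJordanType (K : Type*) [Field K] {n : ℕ} (P Q : n.Partition) : Prop :=
  ∃ D : Set (Matrix (Vertex P) (Vertex P) K),
    IsZariskiOpenDense (nilCommutator K P) D ∧ ∀ A ∈ D, HasJordanType A Q

/-! ### The algebra `U_B` and adequate matrices -/

/-- The algebra `U_B`: the matrices that commute with `B = J_P` and map each cyclic vector
`(1, i, k)` to a vector with coefficient `0` on `(1, i, k')` for all `k' ≤ k`. -/
def upperCommutator (K : Type*) [Field K] {n : ℕ} (P : n.Partition) :
    Set (Matrix (Vertex P) (Vertex P) K) :=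
  {A | Commute A (jordanMatrix K P) ∧
    ∀ v w : Vertex P, v.pos = 1 → w.pos = 1 → w.level = v.level → w.row ≤ v.row → A w v = 0}

/-- The elements of `S_P` other than the smallest part. -/
def nonMin {n : ℕ} (P : n.Partition) : Finset ℕ :=
  (supp P).filter fun i => ∃ j ∈ supp P, j < i

/-- `i⁻ = max {s ∈ S_P | s < i}`; it is used only for `i` in `nonMin P`. -/
def prev {n : ℕ} (P : n.Partition) (i : ℕ) : ℕ :=
  ((supp P).filter fun s => s < i).sup id

/-- `S_P''`: the minima of the maximal sets `{a, a + 1, …, b}` of consecutive integers in `S_P`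
that have odd cardinality. -/
def oddMin {n : ℕ} (P : n.Partition) : Finset ℕ :=
  (supp P).filter fun a => ∃ b ∈ supp P,
    Finset.Icc a b ⊆ supp P ∧ a - 1 ∉ supp P ∧ b + 1 ∉ supp P ∧ Odd (Finset.Icc a b).card

section ElementaryMaps

variable (K : Type*) [Field K] {n : ℕ} (P : n.Partition)

/-- `β_i` maps `(u, i, n_i)` to `(u, i⁻, 1)` for `1 ≤ u ≤ i⁻`, other basis vectors to `0`. -/
def betaMap (i : ℕ) : Matrix (Vertex P) (Vertex P) K :=
  Matrix.of fun w v =>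
    if (v.level = i ∧ v.row = mult P i) ∧
      (w.pos = v.pos ∧ w.level = prev P i ∧ w.row = 1) then 1 else 0

/-- `α_i` maps `(u, i⁻, n_{i⁻})` to `(u + i - i⁻, i, 1)`, other basis vectors to `0`. -/
def alphaMap (i : ℕ) : Matrix (Vertex P) (Vertex P) K :=
  Matrix.of fun w v =>
    if (v.level = prev P i ∧ v.row = mult P (prev P i)) ∧
      (w.pos + prev P i = v.pos + i ∧ w.level = i ∧ w.row = 1) then 1 else 0

/-- `e_{i,k}` maps `(u, i, k)` to `(u, i, k + 1)`, other basis vectors to `0`. -/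
def eMap (i k : ℕ) : Matrix (Vertex P) (Vertex P) K :=
  Matrix.of fun w v =>
    if (v.level = i ∧ v.row = k) ∧
      (w.pos = v.pos ∧ w.level = i ∧ w.row = k + 1) then 1 else 0

/-- `w_ℓ` maps `(u, ℓ, n_ℓ)` to `(u + 1, ℓ, 1)` for `1 ≤ u < ℓ`, other basis vectors to `0`. -/
def wMap (l : ℕ) : Matrix (Vertex P) (Vertex P) K :=
  Matrix.of fun w v =>
    if (v.level = l ∧ v.row = mult P l) ∧
      (w.pos = v.pos + 1 ∧ w.level = l ∧ w.row = 1) then 1 else 0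

end ElementaryMaps

/-- `A ∈ U_B` is adequate if
`A = ∑_i (s_i β_i + t_i α_i) + ∑_{i, 1 ≤ k < n_i} t_{i,k} e_{i,k} + ∑_ℓ z_ℓ w_ℓ`,
the sums running over `i ∈ S_P` not minimal, `i ∈ S_P` and `ℓ ∈ S_P''` respectively,
with all the coefficients non-zero. -/
def IsAdequate {K : Type*} [Field K] {n : ℕ} {P : n.Partition}
    (A : Matrix (Vertex P) (Vertex P) K) : Prop :=
  A ∈ upperCommutator K P ∧
  ∃ (s t : ℕ → K) (t' : ℕ → ℕ → K) (z : ℕ → K),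
    (∀ i ∈ nonMin P, s i ≠ 0 ∧ t i ≠ 0) ∧
    (∀ i ∈ supp P, ∀ k ∈ Finset.Ico 1 (mult P i), t' i k ≠ 0) ∧
    (∀ l ∈ oddMin P, z l ≠ 0) ∧
    A = ∑ i ∈ nonMin P, (s i • betaMap K P i + t i • alphaMap K P i)
      + ∑ i ∈ supp P, ∑ k ∈ Finset.Ico 1 (mult P i), t' i k • eMap K P i k
      + ∑ l ∈ oddMin P, z l • wMap K P l

end Oblak

/-!
The generic Jordan type exists because the nilpotent commutator `N_B` is irreducible. Every
`A ∈ N_B` has the form `g * u * adj g` with `u` in the linear space `U_B` and `g` an invertible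
matrix commuting with `B`: the coefficients of the `A (1, i, k)` on the `(1, i, k')` form nilpotent
matrices, one for each `i`, which are made strictly triangular by matrices that lift to the
commutator of `B` (`exists_conj_mem_upperCommutator`). Joining two pairs `(g, u)` by a line reduces
irreducibility to the fact that a product of non-zero polynomials in one variable is non-zero
(`nilCommutator_irreducible`). So the ranks of all powers of `A` take their maximal values
simultaneously on the non-vanishing set of a single product of minors, and they determine the
Jordan type.

For the bound by `λ_U`, the first `s` parts of the Jordan type of `A` have a sum at least the
dimension of any `A`-invariant subspace generated by `s` vectors (`card_le_sum_partSeq`). So for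
each `s` it suffices that one minor, whose columns are vectors `A ^ k v` with `v` among the first
`s` vertices of the first row of maximal length, is non-zero and has `u_s` rows. Non-vanishing of
these minors is an open condition, which passes to the generic element of `N_B` as soon as one
adequate matrix satisfies it. As a product of non-zero polynomials in the coefficients is non-zero,
one may treat each `s` separately, and allow the coefficients to depend on an indeterminate `X`.

Fix labels `A` with an `s`-`U`-chain of maximal size; after shifting labels up along runs of
consecutive parts, a label `b` with `b - 1 ∉ S_P` lies in `S_P''` (`exists_shifted_labels`). The
chain is a union of `s` disjoint paths in the graph of the elementary maps `β`, `α`, `e`, `w`: the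
path of the `c`-th smallest label `b` descends from the top level in position `c`, runs through the
levels `b` and `b - 1` from left to right, and ascends again at distance `c - 1` from the right end
of the rows. Let the coefficients be powers of `X`, and conjugate by a diagonal matrix of powers of
`X` whose exponents are a potential of the vertices. The result is polynomial in `X` if no map
raises the potential by more than its weight, and for `X = 0` only the tight maps survive. The
potential of `(u, i, k)` is a sum of slopes, `∑ v < u, min (p v) (p (i - v)) (κ i)`, where `κ`
increases with the level, except that it takes the same value on the two levels `b - 1`, `b` of a
label, and `p` is interleaved with `κ` according to the number of chains passing a level. Since
these slopes are symmetric under reversal of the rows, the maps `α` behave like the maps `β`. It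
turns out that at most one tight map leaves each vertex (`Tight.unique`), and that each vertex of
the chain other than the `s` starting points is reached by a tight map from the chain
(`exists_tight_pred`). Hence at `X = 0` the minor is that of an identity matrix
(`exists_powMinor`).
-/

namespace Oblak
open Polynomial Module

/-! ### Jordan bases, triangular form and minors -/

/-- A decomposition of `V`, as a `K[X]`-module through `f`, into cyclic modules annihilated by
powers of `X` gives a Jordan basis of `f`. -/
theorem jordan_basis_of_decomposition {K V : Type*} [Field K] [AddCommGroup V] [Module K V]
    (f : Module.End K V) {d : ℕ} (k : Fin d → ℕ) {N : Fin d → Type*}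
    [∀ i, AddCommGroup (N i)] [∀ i, Module K[X] (N i)] [∀ i, Module K (N i)]
    [∀ i, IsScalarTower K K[X] (N i)] (g : ∀ i, N i) (bb : ∀ i, Basis (Fin (k i)) K (N i))
    (hbb : ∀ i (j : Fin (k i)), bb i j = (X ^ (j : ℕ) : K[X]) • g i)
    (hg : ∀ i, (X ^ k i : K[X]) • g i = 0) (e : AEval' f ≃ₗ[K[X]] Π₀ i, N i) :
    ∃ b : Basis (Σ i, Fin (k i)) K V,
      ∀ i (j : Fin (k i)), f (b ⟨i, j⟩) =
        if h : (j : ℕ) + 1 < k i then b ⟨i, ⟨j + 1, h⟩⟩ else 0 := by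
  classical
  let b0 : Basis (Σ i, Fin (k i)) K (Π₀ i, N i) := DFinsupp.basis bb
  let e' : AEval' f ≃ₗ[K] (Π₀ i, N i) := e.restrictScalars K
  let b : Basis (Σ i, Fin (k i)) K V := b0.map (e'.symm.trans (AEval'.of f).symm)
  refine ⟨b, ?_⟩
  have hb : ∀ i j, b ⟨i, j⟩ = (AEval'.of f).symm (e.symm
      (DFinsupp.single i ((X ^ (j : ℕ) : K[X]) • g i))) := by
    intro i j
    rw [← hbb]
    have h1 : b ⟨i, j⟩ = (AEval'.of f).symm (e.symm (b0 ⟨i, j⟩)) := by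
      simp [b, e']
    have : b0 ⟨i, j⟩ = DFinsupp.single i (bb i j) := by
      apply b0.repr.injective
      rw [Basis.repr_self]
      simp only [b0, DFinsupp.basis]
      rw [LinearEquiv.trans_apply, ← LinearEquiv.symm_apply_eq, LinearEquiv.symm_symm]
      simp [DFinsupp.mapRange_single]
    rw [h1, this]
  have hf' : ∀ x, f ((AEval'.of f).symm x) = (AEval'.of f).symm ((X : K[X]) • x) := by
    intro x
    obtain ⟨y, rfl⟩ := (AEval'.of f).surjective x
    rw [AEval'.X_smul_of]; simp
  intro i j
  have h1 : f (b ⟨i, j⟩) = (AEval'.of f).symm (e.symm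
      (DFinsupp.single i ((X ^ ((j : ℕ) + 1) : K[X]) • g i))) := by
    rw [hb, hf', ← map_smul, ← DFinsupp.single_smul, smul_smul, ← pow_succ']
  rw [h1]
  split_ifs with h
  · rw [hb]
  · have hk : (j : ℕ) + 1 = k i := by have := j.2; omega
    rw [hk, hg]; simp

/-- The Jordan normal form of a nilpotent endomorphism. -/
theorem exists_jordan_basis {K V : Type*} [Field K] [AddCommGroup V] [Module K V]
    [FiniteDimensional K V] (f : Module.End K V) (hf : IsNilpotent f) :
    ∃ (d : ℕ) (k : Fin d → ℕ) (b : Basis (Σ i, Fin (k i)) K V),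
      ∀ i (j : Fin (k i)), f (b ⟨i, j⟩) =
        if h : (j : ℕ) + 1 < k i then b ⟨i, ⟨j + 1, h⟩⟩ else 0 := by
  classical
  obtain ⟨N, hN⟩ := hf
  have htors : Module.IsTorsion' (AEval' f) (Submonoid.powers (X : K[X])) := by
    intro x
    refine ⟨⟨X ^ N, N, rfl⟩, ?_⟩
    obtain ⟨y, rfl⟩ := (AEval'.of f).surjective x
    change (X ^ N : K[X]) • (AEval'.of f y) = 0
    rw [AEval'.X_pow_smul_of, hN]
    simp
  obtain ⟨d, k, ⟨e⟩⟩ := Module.torsion_by_prime_power_decomposition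
    (p := (X : K[X])) irreducible_X htors
  let pb : ∀ i, PowerBasis K (AdjoinRoot ((X : K[X]) ^ k i)) :=
    fun i => AdjoinRoot.powerBasis' (monic_X_pow (k i))
  have hdim : ∀ i, (pb i).dim = k i := fun i => by simp [pb]
  let bb := fun i => ((pb i).basis.reindex (finCongr (hdim i)))
  have hbb : ∀ i j, bb i j = AdjoinRoot.mk _ ((X : K[X]) ^ (j : ℕ)) := by
    intro i j
    have : (pb i).basis (Fin.cast (hdim i).symm j) = (pb i).gen ^ (j : ℕ) := by
      rw [PowerBasis.basis_eq_pow]; rfl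
    refine ((Basis.reindex_apply _ _ _).trans this).trans ?_
    rw [AdjoinRoot.powerBasis'_gen]
    change (AdjoinRoot.mk _ X) ^ (j : ℕ) = _
    rw [← map_pow]
  refine ⟨d, k, jordan_basis_of_decomposition f k
    (fun i => (Submodule.Quotient.mk (1 : K[X]))) bb ?_ ?_ e⟩
  · intro i j
    refine (hbb i j).trans ?_
    rw [← Submodule.Quotient.mk_smul, smul_eq_mul, mul_one]; rfl
  · intro i
    rw [← Submodule.Quotient.mk_smul, Submodule.Quotient.mk_eq_zero, smul_eq_mul, mul_one]
    exact Submodule.mem_span_singleton_self _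

/-- A nilpotent matrix over any field is conjugate to a strictly lower triangular one: list a
Jordan basis block by block. -/
theorem exists_strictly_triangular {K : Type*} [Field K] {m : ℕ} (M : Matrix (Fin m) (Fin m) K)
    (hM : IsNilpotent M) :
    ∃ g h T : Matrix (Fin m) (Fin m) K, g * h = 1 ∧ h * g = 1 ∧ M * g = g * T ∧
      ∀ k' k, k' ≤ k → T k' k = 0 := by
  classical
  have hf : IsNilpotent (Matrix.toLin' M) := by
    obtain ⟨N, hN⟩ := hM
    exact ⟨N, by rw [← Matrix.toLin'_pow, hN, map_zero]⟩
  obtain ⟨d, k, b, hb⟩ := exists_jordan_basis (Matrix.toLin' M) hf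
  have hcard : ∑ i, k i = m := by
    have h := finrank_eq_card_basis b
    simpa using h.symm
  let E : (Σ i, Fin (k i)) ≃ Fin m := finSigmaFinEquiv.trans (finCongr hcard)
  let b' : Basis (Fin m) K (Fin m → K) := b.reindex E
  let T : Matrix (Fin m) (Fin m) K := LinearMap.toMatrix b' b' (Matrix.toLin' M)
  have hMl : LinearMap.toMatrix (Pi.basisFun K (Fin m)) (Pi.basisFun K (Fin m))
      (Matrix.toLin' M) = M := LinearMap.toMatrix'_toLin' M
  refine ⟨(Pi.basisFun K (Fin m)).toMatrix b', b'.toMatrix (Pi.basisFun K (Fin m)), T,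
    Basis.toMatrix_mul_toMatrix_flip _ _, Basis.toMatrix_mul_toMatrix_flip _ _, ?_, ?_⟩
  · nth_rewrite 1 [← hMl]
    rw [linearMap_toMatrix_mul_basis_toMatrix, basis_toMatrix_mul_linearMap_toMatrix]
  · intro k' l hkl
    obtain ⟨⟨i, j⟩, rfl⟩ := E.surjective l
    simp only [T, LinearMap.toMatrix_apply, b', Basis.reindex_apply, Equiv.symm_apply_apply, hb]
    split_ifs with h
    · rw [Basis.repr_reindex_apply, Basis.repr_self, Finsupp.single_apply, if_neg]
      rintro h'
      rw [eq_comm, Equiv.symm_apply_eq] at h'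
      rw [h', Fin.le_def] at hkl
      simp [E, finSigmaFinEquiv_apply] at hkl
    · simp

theorem exists_linearIndependent_submatrix {K m n : Type*} [Field K] [Fintype n] [Finite m]
    (A : Matrix m n K) {r : ℕ} (hr : A.rank = r) :
    ∃ q : Fin r → n, LinearIndependent K (A.submatrix id q).col := by
  classical
  obtain ⟨κ, a, ha, hsp, hli⟩ := exists_linearIndependent' K A.col
  have : Finite κ := Finite.of_injective a ha
  have : Fintype κ := Fintype.ofFinite κ
  have hc : Fintype.card κ = r := by
    rw [← hr, Matrix.rank_eq_finrank_span_cols, ← hsp, finrank_span_eq_card hli]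
  let e : Fin r ≃ κ := (Fintype.equivFinOfCardEq hc).symm
  exact ⟨a ∘ e, hli.comp e e.injective⟩

theorem exists_submatrix_det_ne_zero {K m n : Type*} [Field K] [Fintype n] [Fintype m]
    (A : Matrix m n K) :
    ∃ (p : Fin A.rank → m) (q : Fin A.rank → n), (A.submatrix p q).det ≠ 0 := by
  classical
  obtain ⟨q, hq⟩ := exists_linearIndependent_submatrix A rfl
  have hr : (A.submatrix id q).transpose.rank = A.rank := by
    rw [Matrix.rank_transpose, Matrix.rank_eq_finrank_span_cols, finrank_span_eq_card hq]; simp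
  obtain ⟨p, hp⟩ := exists_linearIndependent_submatrix _ hr
  refine ⟨p, q, fun h0 => ?_⟩
  have h1 := (Matrix.isUnit_iff_isUnit_det _).1 (Matrix.linearIndependent_cols_iff_isUnit.1 hp)
  apply h1.ne_zero
  rw [← h0, ← Matrix.det_transpose]
  rfl

theorem le_rank_of_submatrix_det_ne_zero {K m n : Type*} [Field K] [Fintype n] [Fintype m]
    {r : ℕ} (A : Matrix m n K) (p : Fin r → m) (q : Fin r → n)
    (h : (A.submatrix p q).det ≠ 0) : r ≤ A.rank := by
  have h1 := Matrix.rank_of_isUnit _ ((Matrix.isUnit_iff_isUnit_det _).2 (Ne.isUnit h))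
  rw [Fintype.card_fin] at h1
  have := Matrix.rank_submatrix_le A p q
  omega

/-! ### Vertices, conjugate partitions and partial sums of parts -/

theorem mult_pos_iff {n : ℕ} {P : n.Partition} {i : ℕ} : 0 < mult P i ↔ i ∈ supp P := by
  rw [mult, Multiset.count_pos, supp, Multiset.mem_toFinset]

theorem mem_vertices {n : ℕ} {P : n.Partition} {u i k : ℕ} :
    (u, i, k) ∈ vertices P ↔ (1 ≤ u ∧ u ≤ i) ∧ (1 ≤ k ∧ k ≤ mult P i) := by
  simp only [vertices, Finset.mem_biUnion, Finset.mem_product, Finset.mem_Icc,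
    Finset.mem_singleton]
  constructor
  · rintro ⟨j, -, h1, rfl, h2⟩
    exact ⟨h1, h2⟩
  · rintro ⟨h1, h2⟩
    exact ⟨i, mult_pos_iff.1 (by omega), h1, rfl, h2⟩

theorem sum_vertices {n : ℕ} (P : n.Partition) (f : ℕ × ℕ × ℕ → ℕ) :
    ∑ v : Vertex P, f v.1 =
      ∑ i ∈ supp P, ∑ u ∈ Finset.Icc 1 i, ∑ k ∈ Finset.Icc 1 (mult P i), f (u, i, k) := by
  rw [Finset.univ_eq_attach, Finset.sum_attach (vertices P) f, vertices, Finset.sum_biUnion]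
  · refine Finset.sum_congr rfl fun i _ => ?_
    rw [Finset.sum_product]
    refine Finset.sum_congr rfl fun u _ => ?_
    rw [Finset.sum_product]
    simp
  · intro i _ j _ hij
    rw [Function.onFun, Finset.disjoint_left]
    rintro ⟨u, a, k⟩ h1 h2
    simp only [Finset.mem_product, Finset.mem_singleton] at h1 h2
    exact hij (h1.2.1.symm.trans h2.2.1)

theorem card_vertex {n : ℕ} (P : n.Partition) : Fintype.card (Vertex P) = n := by
  have h := sum_vertices P (fun _ => 1)
  simp only [Finset.sum_const, smul_eq_mul, mul_one, Finset.card_univ, Nat.card_Icc,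
    Nat.add_sub_cancel] at h
  rw [h]
  have h2 := Finset.sum_multiset_count P.parts
  rw [P.parts_sum] at h2
  simp only [supp, mult]
  refine Eq.trans ?_ h2.symm
  refine Finset.sum_congr rfl fun i _ => ?_
  rw [smul_eq_mul, mul_comm]

/-- The number of parts of `Q` that are at least `m`, a part of the conjugate partition. -/
def conj {n : ℕ} (Q : n.Partition) (m : ℕ) : ℕ := Q.parts.countP (m ≤ ·)

theorem card_pos_eq {n : ℕ} (Q : n.Partition) {m : ℕ} (hm : 1 ≤ m) :
    (Finset.univ.filter fun v : Vertex Q => v.pos = m).card = conj Q m := by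
  have h := sum_vertices Q (fun v => if v.1 = m then 1 else 0)
  rw [Finset.card_filter]
  refine Eq.trans h ?_
  have h2 : conj Q m = ∑ i ∈ supp Q, if m ≤ i then mult Q i else 0 := by
    rw [conj, Multiset.countP_eq_card_filter, ← Multiset.toFinset_sum_count_eq,
      Multiset.toFinset_filter, Finset.sum_filter]
    refine Finset.sum_congr rfl fun i _ => ?_
    split_ifs with hi
    · rw [Multiset.count_filter_of_pos hi, mult]
    · rfl
  rw [h2]
  refine Finset.sum_congr rfl fun i _ => ?_
  have h3 : ∀ u : ℕ, (∑ k ∈ Finset.Icc 1 (mult Q i), if u = m then 1 else 0) =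
      if u = m then mult Q i else 0 := fun u => by split_ifs <;> simp
  simp only [h3, Finset.sum_ite_eq', Finset.mem_Icc, hm, true_and]

/-- A partition is determined by its conjugate. -/
theorem eq_of_conj_eq {n : ℕ} {Q Q' : n.Partition} (h : ∀ m, 1 ≤ m → conj Q m = conj Q' m) :
    Q = Q' := by
  have key : ∀ (R : n.Partition) m, conj R m = R.parts.count m + conj R (m + 1) := by
    intro R m
    simp only [conj]
    induction R.parts using Multiset.induction_on with
    | empty => simp
    | cons a s ih =>
      simp only [Multiset.countP_cons, Multiset.count_cons, ih]
      split_ifs <;> omega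
  ext m
  rcases Nat.eq_zero_or_pos m with rfl | hm
  · rw [Multiset.count_eq_zero_of_notMem, Multiset.count_eq_zero_of_notMem]
    · exact fun h0 => (Q'.parts_pos h0).ne' rfl
    · exact fun h0 => (Q.parts_pos h0).ne' rfl
  · have h1 := key Q m
    have h2 := key Q' m
    have h3 := h m hm
    have h4 := h (m + 1) (by omega)
    omega

theorem le_getD_of_lt_countP {l : List ℕ} (hl : l.Pairwise (· ≥ ·)) {m j : ℕ}
    (hj : j < l.countP (m ≤ ·)) : m ≤ l.getD j 0 := by
  induction l generalizing j with
  | nil => simp at hj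
  | cons a t ih =>
    rw [List.pairwise_cons] at hl
    cases j with
    | zero =>
      obtain ⟨b, hb, hmb⟩ := List.countP_pos_iff.1 hj
      rcases List.mem_cons.1 hb with rfl | hb
      · simpa using hmb
      · have := hl.1 b hb
        simp at hmb ⊢; omega
    | succ j =>
      rw [List.getD_cons_succ]
      apply ih hl.2
      rw [List.countP_cons] at hj
      split_ifs at hj <;> omega

/-- Truncating the rows of the conjugate diagram at `s` leaves at most the first `s` columns, whose
lengths are the first `s` parts. -/
theorem sum_min_conj_le {n : ℕ} (Q : n.Partition) (s : ℕ) :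
    ((∑ m ∈ Finset.Icc 1 n, min s (conj Q m) : ℕ) : ℤ) ≤ ∑ j ∈ Finset.range s, partSeq Q j := by
  simp only [partSeq]
  rw [← Nat.cast_sum, Nat.cast_le]
  set l := Q.parts.sort (· ≥ ·) with hl
  have hs : l.Pairwise (· ≥ ·) := Multiset.pairwise_sort _ _
  have hc : ∀ m, conj Q m = l.countP (m ≤ ·) := by
    intro m
    rw [conj, ← Multiset.coe_countP, hl, Multiset.sort_eq]
  calc ∑ m ∈ Finset.Icc 1 n, min s (conj Q m)
      ≤ ∑ m ∈ Finset.Icc 1 n, ((Finset.range s).filter fun j => m ≤ l.getD j 0).card := by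
        refine Finset.sum_le_sum fun m _ => ?_
        calc min s (conj Q m) = (Finset.range (min s (conj Q m))).card := by simp
          _ ≤ _ := by
            apply Finset.card_le_card
            intro j hj
            rw [Finset.mem_range, lt_min_iff] at hj
            rw [Finset.mem_filter, Finset.mem_range]
            exact ⟨hj.1, le_getD_of_lt_countP hs (by rw [← hc]; exact hj.2)⟩
    _ = ∑ j ∈ Finset.range s, ((Finset.Icc 1 n).filter fun m => m ≤ l.getD j 0).card := by
        simp only [Finset.card_filter]
        exact Finset.sum_comm
    _ ≤ _ := by
        refine Finset.sum_le_sum fun j _ => ?_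
        calc _ ≤ (Finset.Icc 1 (l.getD j 0)).card := by
              apply Finset.card_le_card
              intro m hm
              simp only [Finset.mem_filter, Finset.mem_Icc] at hm ⊢
              omega
          _ = _ := by simp
end Oblak

/-! ### Jordan types of nilpotent matrices -/

namespace Oblak
open Module

namespace Vertex
variable {n : ℕ} {P : n.Partition}

theorem ext' {v w : Vertex P} (h1 : v.pos = w.pos) (h2 : v.level = w.level)
    (h3 : v.row = w.row) : v = w :=
  Subtype.ext (Prod.ext h1 (Prod.ext h2 h3))

theorem bounds (v : Vertex P) :
    (1 ≤ v.pos ∧ v.pos ≤ v.level) ∧ (1 ≤ v.row ∧ v.row ≤ mult P v.level) :=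
  mem_vertices.1 v.2

theorem level_mem (v : Vertex P) : v.level ∈ supp P :=
  mult_pos_iff.1 (by have := v.bounds; omega)

/-- The vertex with the given coordinates. -/
def mk (u i k : ℕ) (h : (1 ≤ u ∧ u ≤ i) ∧ (1 ≤ k ∧ k ≤ mult P i)) : Vertex P :=
  ⟨(u, i, k), mem_vertices.2 h⟩

/-- The vertex `k` steps to the right in the same row. -/
def shift (v : Vertex P) (k : ℕ) (h : v.pos + k ≤ v.level) : Vertex P :=
  mk (v.pos + k) v.level v.row (by have := v.bounds; omega)

end Vertex

variable {K : Type*} [Field K] {n : ℕ} {P Q : n.Partition}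

theorem le_of_mem_supp {i : ℕ} (hi : i ∈ supp P) : i ≤ n := by
  rw [supp, Multiset.mem_toFinset] at hi
  exact (Multiset.le_sum_of_mem hi).trans_eq P.parts_sum

theorem jordanMatrix_mulVec_single {v w : Vertex P} (h1 : w.pos = v.pos + 1)
    (h2 : w.level = v.level) (h3 : w.row = v.row) :
    (jordanMatrix K P).mulVec (Pi.single v 1) = Pi.single w 1 := by
  ext x
  rw [Matrix.mulVec_single_one, Matrix.col_apply, jordanMatrix, Matrix.of_apply, Pi.single_apply]
  refine if_congr ⟨fun h => ?_, fun h => ?_⟩ rfl rfl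
  · exact Vertex.ext' (h.1.trans h1.symm) (h.2.1.trans h2.symm) (h.2.2.trans h3.symm)
  · rw [h]; exact ⟨h1, h2, h3⟩

theorem jordanMatrix_mulVec_single_of_level {v : Vertex P} (h : v.pos = v.level) :
    (jordanMatrix K P).mulVec (Pi.single v 1) = 0 := by
  ext x
  rw [Matrix.mulVec_single_one, Matrix.col_apply, jordanMatrix, Matrix.of_apply, if_neg]
  · rfl
  · rintro ⟨h1, h2, -⟩
    have := x.bounds
    omega

theorem jordanMatrix_pow_mulVec_single (v : Vertex P) (k : ℕ) :
    (jordanMatrix K P ^ k).mulVec (Pi.single v 1) =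
      if h : v.pos + k ≤ v.level then Pi.single (v.shift k h) 1 else 0 := by
  induction k with
  | zero =>
    rw [dif_pos (by have := v.bounds; omega), pow_zero, Matrix.one_mulVec]
    rfl
  | succ k ih =>
    rw [pow_succ', ← Matrix.mulVec_mulVec, ih]
    split_ifs with h1 h2 h2
    · exact jordanMatrix_mulVec_single rfl rfl rfl
    · apply jordanMatrix_mulVec_single_of_level
      change v.pos + k = v.level
      omega
    · omega
    · exact Matrix.mulVec_zero _

theorem rank_jordanMatrix_pow (k : ℕ) :
    (jordanMatrix K P ^ k).rank = (Finset.univ.filter fun w : Vertex P => k < w.pos).card := by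
  classical
  rw [Matrix.rank_eq_finrank_span_cols]
  let b : {w : Vertex P // k < w.pos} → (Vertex P → K) := fun w => Pi.single w.1 1
  have hspan : Submodule.span K (Set.range (jordanMatrix K P ^ k).col) =
      Submodule.span K (Set.range b) := by
    apply le_antisymm
    · rw [Submodule.span_le]
      rintro _ ⟨v, rfl⟩
      rw [← Matrix.mulVec_single_one, jordanMatrix_pow_mulVec_single]
      split_ifs with h
      · refine Submodule.subset_span ⟨⟨v.shift k h, ?_⟩, rfl⟩
        have := v.bounds
        change k < v.pos + k
        omega
      · exact Submodule.zero_mem _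
    · rw [Submodule.span_le]
      rintro _ ⟨w, rfl⟩
      have hw := w.1.bounds
      have hk := w.2
      let v : Vertex P := Vertex.mk (w.1.pos - k) w.1.level w.1.row (by omega)
      refine Submodule.subset_span ⟨v, ?_⟩
      rw [← Matrix.mulVec_single_one, jordanMatrix_pow_mulVec_single, dif_pos]
      · have : v.shift k (by change w.1.pos - k + k ≤ w.1.level; omega) = w.1 :=
          Vertex.ext' (by change w.1.pos - k + k = w.1.pos; omega) rfl rfl
        rw [this]
      · change w.1.pos - k + k ≤ w.1.level
        omega
  have hli : LinearIndependent K b := by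
    have h := (Pi.basisFun K (Vertex P)).linearIndependent.comp
      (Subtype.val : {w : Vertex P // k < w.pos} → Vertex P) Subtype.val_injective
    convert! h using 1
    ext w x
    simp [b]
  rw [hspan, finrank_span_eq_card hli, Fintype.card_subtype]

/-- The ranks of the powers of `J_P` drop by the parts of the conjugate partition, so they
determine `P`. -/
theorem rank_jordanMatrix_pow_eq_add (k : ℕ) :
    (jordanMatrix K P ^ k).rank = (jordanMatrix K P ^ (k + 1)).rank + conj P (k + 1) := by
  rw [rank_jordanMatrix_pow, rank_jordanMatrix_pow, ← card_pos_eq P (Nat.le_add_left 1 k),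
    ← Finset.card_union_of_disjoint]
  · congr 1
    ext v
    simp only [Finset.mem_filter, Finset.mem_union, Finset.mem_univ, true_and]
    omega
  · rw [Finset.disjoint_filter]
    intro v _ h1 h2
    omega

theorem jordanMatrix_pow_eq_zero : jordanMatrix K P ^ n = 0 := by
  refine Matrix.ext_of_mulVec_single fun v => ?_
  rw [jordanMatrix_pow_mulVec_single, dif_neg, Matrix.zero_mulVec]
  have := v.bounds
  have := le_of_mem_supp v.level_mem
  omega

theorem HasJordanType.pow_mulVec {A : Matrix (Vertex P) (Vertex P) K}
    {e : (Vertex P → K) ≃ₗ[K] (Vertex Q → K)}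
    (he : ∀ x, e (A.mulVec x) = (jordanMatrix K Q).mulVec (e x)) (k : ℕ) (x : Vertex P → K) :
    e ((A ^ k).mulVec x) = (jordanMatrix K Q ^ k).mulVec (e x) := by
  induction k with
  | zero => simp
  | succ k ih => rw [pow_succ', pow_succ', ← Matrix.mulVec_mulVec, ← Matrix.mulVec_mulVec, he, ih]

theorem HasJordanType.rank_pow {A : Matrix (Vertex P) (Vertex P) K} (h : HasJordanType A Q)
    (k : ℕ) : (A ^ k).rank = (jordanMatrix K Q ^ k).rank := by
  obtain ⟨e, he⟩ := h
  have h1 : (e : (Vertex P → K) →ₗ[K] (Vertex Q → K)) ∘ₗ (A ^ k).mulVecLin =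
      (jordanMatrix K Q ^ k).mulVecLin ∘ₗ (e : (Vertex P → K) →ₗ[K] (Vertex Q → K)) :=
    LinearMap.ext fun x => HasJordanType.pow_mulVec he k x
  rw [Matrix.rank, Matrix.rank, ← LinearMap.range_comp_of_range_eq_top
    (jordanMatrix K Q ^ k).mulVecLin e.range, ← h1, LinearMap.range_comp]
  exact (LinearEquiv.finrank_map_eq e _).symm

theorem HasJordanType.unique {A : Matrix (Vertex P) (Vertex P) K} {Q' : n.Partition}
    (h : HasJordanType A Q) (h' : HasJordanType A Q') : Q = Q' := by
  apply eq_of_conj_eq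
  intro m hm
  obtain ⟨k, rfl⟩ : ∃ k, m = k + 1 := ⟨m - 1, by omega⟩
  have h1 := rank_jordanMatrix_pow_eq_add (K := K) (P := Q) k
  have h2 := rank_jordanMatrix_pow_eq_add (K := K) (P := Q') k
  rw [← h.rank_pow, ← h.rank_pow] at h1
  rw [← h'.rank_pow, ← h'.rank_pow] at h2
  omega

/-- The rows of equal length of the Jordan diagram are numbered in the order in which the Jordan
basis lists its blocks. -/
theorem exists_hasJordanType {A : Matrix (Vertex P) (Vertex P) K} (hA : IsNilpotent A) :
    ∃ Q : n.Partition, HasJordanType A Q := by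
  classical
  have hf : IsNilpotent A.mulVecLin := by
    obtain ⟨N, hN⟩ := hA
    exact ⟨N, by rw [← Matrix.toLin'_apply', ← Matrix.toLin'_pow, hN, map_zero]⟩
  obtain ⟨d, k, b, hb⟩ := exists_jordan_basis A.mulVecLin hf
  have hcard : ∑ i, k i = n := by
    have h := finrank_eq_card_basis b
    simp only [finrank_fintype_fun_eq_card, card_vertex, Fintype.card_sigma, Fintype.card_fin] at h
    exact h.symm
  let Q : n.Partition :=
    { parts := (Finset.univ.filter fun i => 0 < k i).val.map k
      parts_pos := by
        intro i hi
        obtain ⟨j, hj, rfl⟩ := Multiset.mem_map.1 hi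
        have hj' : j ∈ Finset.univ.filter (fun i => 0 < k i) := hj
        exact (Finset.mem_filter.1 hj').2
      parts_sum := by
        rw [← hcard, ← Finset.sum_filter_add_sum_filter_not Finset.univ (fun i => 0 < k i) k]
        rw [Finset.sum_eq_zero (s := Finset.univ.filter fun i => ¬ 0 < k i)]
        · rfl
        · intro i hi
          have := (Finset.mem_filter.1 hi).2
          omega }
  have hmult : ∀ m, 0 < m → mult Q m = (Finset.univ.filter fun i => k i = m).card := by
    intro m hm
    simp only [mult, Q]
    rw [Multiset.count_map, ← Finset.filter_val, Finset.card_val, Finset.filter_filter]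
    congr 1
    ext i
    simp only [Finset.mem_filter, Finset.mem_univ, true_and]
    omega
  let r : Fin d → ℕ := fun i => (Finset.univ.filter fun i' => k i' = k i ∧ i' ≤ i).card
  have hr : ∀ i i', k i = k i' → r i = r i' → i = i' := by
    have aux : ∀ i i', k i = k i' → i < i' → r i < r i' := by
      intro i i' hk hlt
      apply Finset.card_lt_card
      rw [Finset.ssubset_iff_of_subset]
      · exact ⟨i', by simp, by simp [hlt]⟩
      · intro j hj
        simp only [Finset.mem_filter, Finset.mem_univ, true_and] at hj ⊢
        exact ⟨hj.1.trans hk, hj.2.trans hlt.le⟩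
    intro i i' hk h
    rcases lt_trichotomy i i' with h1 | h1 | h1
    · exact absurd h (aux i i' hk h1).ne
    · exact h1
    · exact absurd h.symm (aux i' i hk.symm h1).ne
  let φ : (Σ i, Fin (k i)) → Vertex Q := fun x => Vertex.mk (x.2 + 1) (k x.1) (r x.1) (by
    have h2 := x.2.2
    refine ⟨by omega, ?_, ?_⟩
    · exact Finset.card_pos.2 ⟨x.1, by simp⟩
    · rw [hmult _ (by omega)]
      apply Finset.card_le_card
      intro j hj
      simp only [Finset.mem_filter, Finset.mem_univ, true_and] at hj ⊢
      exact hj.1)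
  have hφ : Function.Injective φ := by
    rintro ⟨i, j⟩ ⟨i', j'⟩ h
    have h1 : (j : ℕ) + 1 = j' + 1 := congrArg Vertex.pos h
    have h2 : k i = k i' := congrArg Vertex.level h
    have h3 : r i = r i' := congrArg Vertex.row h
    obtain rfl := hr _ _ h2 h3
    have : j = j' := Fin.ext (by omega)
    rw [this]
  have hφb : Function.Bijective φ := by
    rw [Fintype.bijective_iff_injective_and_card]
    refine ⟨hφ, ?_⟩
    rw [card_vertex]
    simpa using hcard
  let E := Equiv.ofBijective φ hφb
  refine ⟨Q, b.equiv (Pi.basisFun K (Vertex Q)) E, fun x => ?_⟩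
  have hlin : ((b.equiv (Pi.basisFun K (Vertex Q)) E : (Vertex P → K) ≃ₗ[K] (Vertex Q → K)) :
      (Vertex P → K) →ₗ[K] (Vertex Q → K)) ∘ₗ A.mulVecLin =
      (jordanMatrix K Q).mulVecLin ∘ₗ
        ((b.equiv (Pi.basisFun K (Vertex Q)) E : (Vertex P → K) ≃ₗ[K] (Vertex Q → K)) :
          (Vertex P → K) →ₗ[K] (Vertex Q → K)) := by
    apply b.ext
    rintro ⟨i, j⟩
    simp only [LinearMap.comp_apply, LinearEquiv.coe_coe, hb, Basis.equiv_apply,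
      Pi.basisFun_apply, Matrix.mulVecLin_apply]
    split_ifs with h
    · rw [Basis.equiv_apply, Pi.basisFun_apply]
      exact (jordanMatrix_mulVec_single (v := E ⟨i, j⟩) (w := E ⟨i, ⟨j + 1, h⟩⟩) rfl rfl rfl).symm
    · rw [map_zero]
      symm
      apply jordanMatrix_mulVec_single_of_level
      change (j : ℕ) + 1 = k i
      omega
  exact LinearMap.congr_fun hlin x


/-- Let `W` be generated by `s` vectors as a module over `K[f]`. The dimension drops from `f ^ m W`
to `f ^ (m + 1) W` by at most `s`, the number of generators, and by at most the dimension `d m` of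
`ker f ∩ im (f ^ m)`, which contains the kernel of `f` on `f ^ m W`. -/
theorem finrank_span_orbit_le {V : Type*} [AddCommGroup V] [Module K V] [FiniteDimensional K V]
    (f : Module.End K V) {s : ℕ} (v : Fin s → V) {N : ℕ} (hf : f ^ N = 0) (d : ℕ → ℕ)
    (hd : ∀ m, finrank K (LinearMap.range (f ^ m)) =
      finrank K (LinearMap.range (f ^ (m + 1))) + d m) :
    finrank K (Submodule.span K (Set.range fun p : ℕ × Fin s => (f ^ p.1) (v p.2))) ≤
      ∑ m ∈ Finset.range N, min s (d m) := by
  set W := Submodule.span K (Set.range fun p : ℕ × Fin s => (f ^ p.1) (v p.2)) with hW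
  have hrn : ∀ U : Submodule K V, finrank K U =
      finrank K (U.map f) + finrank K (U ⊓ LinearMap.ker f : Submodule K V) := by
    intro U
    have h := LinearMap.finrank_range_add_finrank_ker (f.domRestrict U)
    rw [LinearMap.range_domRestrict, LinearMap.ker_domRestrict] at h
    rw [← h]
    congr 1
    rw [← Submodule.map_comap_subtype, Submodule.finrank_map_subtype_eq]
  have hpow : ∀ m, LinearMap.range (f ^ (m + 1)) = (LinearMap.range (f ^ m)).map f := by
    intro m
    rw [pow_succ', Module.End.mul_eq_comp, LinearMap.range_comp]
  have hWpow : ∀ m, W.map (f ^ (m + 1)) = (W.map (f ^ m)).map f := by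
    intro m
    rw [pow_succ', Module.End.mul_eq_comp, Submodule.map_comp]
  have hstep : ∀ m, finrank K (W.map (f ^ m)) ≤
      finrank K (W.map (f ^ (m + 1))) + min s (d m) := by
    intro m
    rw [← Nat.add_min_add_left]
    refine le_min ?_ ?_
    · have hle : W.map (f ^ m) ≤ W.map (f ^ (m + 1)) ⊔
          Submodule.span K (Set.range fun j => (f ^ m) (v j)) := by
        rw [hW, Submodule.map_span, Submodule.span_le]
        rintro _ ⟨_, ⟨⟨k, j⟩, rfl⟩, rfl⟩
        rcases k with _ | k
        · exact Submodule.mem_sup_right (Submodule.subset_span ⟨j, by simp⟩)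
        · refine Submodule.mem_sup_left ⟨(f ^ k) (v j), Submodule.subset_span ⟨(k, j), rfl⟩, ?_⟩
          change (f ^ (m + 1)) ((f ^ k) (v j)) = (f ^ m) ((f ^ (k + 1)) (v j))
          rw [← Module.End.mul_apply, ← Module.End.mul_apply, ← pow_add, ← pow_add]
          congr 2
          omega
      refine (Submodule.finrank_mono hle).trans ((Submodule.finrank_add_le_finrank_add_finrank _ _).trans ?_)
      gcongr
      exact (finrank_range_le_card _).trans_eq (Fintype.card_fin s)
    · rw [hrn, ← hWpow]
      gcongr
      have h1 := hrn (LinearMap.range (f ^ m))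
      rw [← hpow] at h1
      have h2 : finrank K (LinearMap.range (f ^ m) ⊓ LinearMap.ker f : Submodule K V) = d m := by
        have := hd m
        omega
      rw [← h2]
      exact Submodule.finrank_mono (inf_le_inf_right _ LinearMap.map_le_range)
  have hind : ∀ m, finrank K W ≤
      finrank K (W.map (f ^ m)) + ∑ i ∈ Finset.range m, min s (d i) := by
    intro m
    induction m with
    | zero =>
      rw [pow_zero, Module.End.one_eq_id, Submodule.map_id]
      exact Nat.le_add_right _ _
    | succ m ih =>
      rw [Finset.sum_range_succ]
      have := hstep m
      omega
  have h := hind N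
  rw [hf, Submodule.map_zero, finrank_bot, zero_add] at h
  exact h

/-- Independent vectors of the form `A ^ k v`, with `s` different `v`, are no more than the sum of
the first `s` parts of the Jordan type. -/
theorem card_le_sum_partSeq {A : Matrix (Vertex P) (Vertex P) K} (h : HasJordanType A Q)
    {ι : Type*} [Fintype ι] {s : ℕ} (v : Fin s → Vertex P → K) (k : ι → ℕ) (c : ι → Fin s)
    (hli : LinearIndependent K fun i => (A ^ k i).mulVec (v (c i))) :
    (Fintype.card ι : ℤ) ≤ ∑ j ∈ Finset.range s, partSeq Q j := by
  have hpow : ∀ m, A.mulVecLin ^ m = (A ^ m).mulVecLin := fun m => by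
    rw [← Matrix.toLin'_apply', ← Matrix.toLin'_apply', Matrix.toLin'_pow]
  have hA : A ^ n = 0 := by
    obtain ⟨e, he⟩ := h
    refine Matrix.ext_of_mulVec_single fun v => e.injective ?_
    rw [HasJordanType.pow_mulVec he, jordanMatrix_pow_eq_zero, Matrix.zero_mulVec,
      Matrix.zero_mulVec, map_zero]
  have hbound := finrank_span_orbit_le A.mulVecLin v (N := n)
    (by rw [hpow, hA, Matrix.mulVecLin_zero]) (fun m => conj Q (m + 1)) (fun m => by
      have := rank_jordanMatrix_pow_eq_add (K := K) (P := Q) m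
      rw [← h.rank_pow, ← h.rank_pow] at this
      rw [hpow, hpow]
      exact this)
  have hsum : ∑ m ∈ Finset.range n, min s (conj Q (m + 1)) =
      ∑ m ∈ Finset.Icc 1 n, min s (conj Q m) := by
    rw [Finset.range_eq_Ico, Finset.sum_Ico_add' (fun m => min s (conj Q m)) 0 n 1]
    rfl
  refine le_trans ?_ (sum_min_conj_le Q s)
  rw [← hsum]
  refine Nat.cast_le.2 (le_trans ?_ hbound)
  rw [← finrank_span_eq_card hli]
  apply Submodule.finrank_mono
  rw [Submodule.span_le]
  rintro _ ⟨i, rfl⟩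
  refine Submodule.subset_span ⟨(k i, c i), ?_⟩
  change (A.mulVecLin ^ k i) _ = _
  rw [hpow]
  rfl

end Oblak

/-! ### The commutator of the Jordan matrix -/

namespace Oblak
open Module

variable {K : Type*} [Field K] {n : ℕ} {P Q : n.Partition}

/-- The vertex one step to the left in the same row. -/
def Vertex.back (v : Vertex P) (h : 1 < v.pos) : Vertex P :=
  Vertex.mk (v.pos - 1) v.level v.row (by have := v.bounds; omega)

theorem mul_jordanMatrix_apply (A : Matrix (Vertex P) (Vertex P) K) (w v : Vertex P) :
    (A * jordanMatrix K P) w v =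
      if h : v.pos + 1 ≤ v.level then A w (v.shift 1 h) else 0 := by
  have h := jordanMatrix_pow_mulVec_single (K := K) v 1
  rw [pow_one] at h
  have h2 : (A * jordanMatrix K P) w v = (A.mulVec ((jordanMatrix K P).mulVec (Pi.single v 1))) w := by
    rw [Matrix.mulVec_mulVec, Matrix.mulVec_single_one, Matrix.col_apply]
  rw [h2, h]
  split_ifs with h3
  · rw [Matrix.mulVec_single_one, Matrix.col_apply]
  · rw [Matrix.mulVec_zero]; rfl

theorem jordanMatrix_mul_apply (A : Matrix (Vertex P) (Vertex P) K) (w v : Vertex P) :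
    (jordanMatrix K P * A) w v = if h : 1 < w.pos then A (w.back h) v else 0 := by
  rw [Matrix.mul_apply]
  split_ifs with h
  · rw [Finset.sum_eq_single (w.back h)]
    · rw [jordanMatrix, Matrix.of_apply, if_pos, one_mul]
      exact ⟨by change w.pos = w.pos - 1 + 1; omega, rfl, rfl⟩
    · intro x _ hx
      rw [jordanMatrix, Matrix.of_apply, if_neg, zero_mul]
      rintro ⟨h1, h2, h3⟩
      exact hx (Vertex.ext' (by change x.pos = w.pos - 1; omega) h2.symm h3.symm)
    · simp
  · refine Finset.sum_eq_zero fun x _ => ?_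
    rw [jordanMatrix, Matrix.of_apply, if_neg, zero_mul]
    rintro ⟨h1, -, -⟩
    have := x.bounds
    omega

theorem commute_shift {A : Matrix (Vertex P) (Vertex P) K} (hA : Commute A (jordanMatrix K P))
    (w v : Vertex P) (hw : w.pos + 1 ≤ w.level) (hv : v.pos + 1 ≤ v.level) :
    A (w.shift 1 hw) (v.shift 1 hv) = A w v := by
  have h := congrFun (congrFun hA.eq (w.shift 1 hw)) v
  have hw' : 1 < (w.shift 1 hw).pos := by
    have := w.bounds
    change 1 < w.pos + 1
    omega
  rw [mul_jordanMatrix_apply, jordanMatrix_mul_apply, dif_pos hv, dif_pos hw'] at h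
  rw [h]
  congr 1

/-- Matrices commuting with `J_P` do not move basis vectors to the left. -/
theorem pos_le_of_commute {A : Matrix (Vertex P) (Vertex P) K}
    (hA : Commute A (jordanMatrix K P)) {w v : Vertex P} (h : A w v ≠ 0) : v.pos ≤ w.pos := by
  obtain ⟨m, hm⟩ : ∃ m, v.pos = m + 1 := ⟨v.pos - 1, by have := v.bounds; omega⟩
  induction m generalizing v w with
  | zero => have := w.bounds; omega
  | succ m ih =>
    have hv : 1 < v.pos := by omega
    have hb := v.bounds
    have hb' := w.bounds
    have hv2 : (v.back hv).pos + 1 ≤ (v.back hv).level := by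
      change v.pos - 1 + 1 ≤ v.level
      omega
    have hvv : (v.back hv).shift 1 hv2 = v :=
      Vertex.ext' (by change v.pos - 1 + 1 = v.pos; omega) rfl rfl
    have h1 := congrFun (congrFun hA.eq w) (v.back hv)
    rw [mul_jordanMatrix_apply, jordanMatrix_mul_apply, dif_pos hv2, hvv] at h1
    split_ifs at h1 with hw
    · have := ih (w := w.back hw) (v := v.back hv) (by rwa [← h1])
        (by change v.pos - 1 = m + 1; omega)
      change v.pos - 1 ≤ w.pos - 1 at this
      omega
    · exact absurd h1 h

/-- Matrices commuting with `J_P` do not increase the distance to the right end of the row. -/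
theorem level_le_of_commute {A : Matrix (Vertex P) (Vertex P) K}
    (hA : Commute A (jordanMatrix K P)) {w v : Vertex P} (h : A w v ≠ 0) :
    w.level + v.pos ≤ v.level + w.pos := by
  obtain ⟨m, hm⟩ : ∃ m, v.level = v.pos + m := ⟨v.level - v.pos, by have := v.bounds; omega⟩
  by_cases hw : w.pos + 1 ≤ w.level
  swap
  · have := w.bounds
    omega
  induction m generalizing v w with
  | zero =>
    have h1 := congrFun (congrFun hA.eq (w.shift 1 hw)) v
    have hw' : 1 < (w.shift 1 hw).pos := by
      have := w.bounds
      change 1 < w.pos + 1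
      omega
    rw [mul_jordanMatrix_apply, jordanMatrix_mul_apply, dif_neg (by omega), dif_pos hw'] at h1
    exact absurd h1.symm h
  | succ m ih =>
    have hv : v.pos + 1 ≤ v.level := by omega
    rw [← commute_shift hA w v hw hv] at h
    by_cases hw2 : (w.shift 1 hw).pos + 1 ≤ (w.shift 1 hw).level
    · have := ih h (by change v.level = v.pos + 1 + m; omega) hw2
      change w.level + (v.pos + 1) ≤ v.level + (w.pos + 1) at this
      omega
    · change ¬ (w.pos + 1 + 1 ≤ w.level) at hw2
      omega

/-- The coefficients between equal positions of two rows of the same length are those between the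
first vertices of these rows. -/
theorem apply_eq_of_commute {A : Matrix (Vertex P) (Vertex P) K}
    (hA : Commute A (jordanMatrix K P)) {w v w' v' : Vertex P} (h1 : w.pos = v.pos)
    (h2 : w.level = v.level) (h3 : w'.level = w.level) (h4 : v'.level = w.level)
    (h5 : w'.row = w.row) (h6 : v'.row = v.row) (h7 : w'.pos = 1) (h8 : v'.pos = 1) :
    A w v = A w' v' := by
  obtain ⟨m, hm⟩ : ∃ m, v.pos = m + 1 := ⟨v.pos - 1, by have := v.bounds; omega⟩
  induction m generalizing v w with
  | zero =>
    rw [Vertex.ext' (v := w') (w := w) (by omega) h3 h5,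
      Vertex.ext' (v := v') (w := v) (by omega) (by omega) h6]
  | succ m ih =>
    have hb := v.bounds
    have hv : 1 < v.pos := by omega
    have hw : 1 < w.pos := by omega
    have hv2 : (v.back hv).pos + 1 ≤ (v.back hv).level := by
      change v.pos - 1 + 1 ≤ v.level
      omega
    have hw2 : (w.back hw).pos + 1 ≤ (w.back hw).level := by
      change w.pos - 1 + 1 ≤ w.level
      omega
    have hvv : (v.back hv).shift 1 hv2 = v :=
      Vertex.ext' (by change v.pos - 1 + 1 = v.pos; omega) rfl rfl
    have hww : (w.back hw).shift 1 hw2 = w :=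
      Vertex.ext' (by change w.pos - 1 + 1 = w.pos; omega) rfl rfl
    rw [← hvv, ← hww, commute_shift hA]
    exact ih (by change w.pos - 1 = v.pos - 1; omega) h2 h3 h4 h5 h6
      (by change v.pos - 1 = m + 1; omega)

theorem isNilpotent_of_height {V : Type*} [Fintype V] [DecidableEq V] {A : Matrix V V K} (ht : V → ℕ)
    (h : ∀ w v, A w v ≠ 0 → ht v < ht w) : IsNilpotent A := by
  have key : ∀ (m : ℕ) (w v : V), (A ^ m) w v ≠ 0 → ht v + m ≤ ht w := by
    intro m
    induction m with
    | zero =>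
      intro w v hwv
      rw [pow_zero, Matrix.one_apply] at hwv
      have : w = v := by
        by_contra h0
        exact hwv (if_neg h0)
      rw [this, add_zero]
    | succ m ih =>
      intro w v hwv
      rw [pow_succ', Matrix.mul_apply] at hwv
      obtain ⟨x, -, hx⟩ := Finset.exists_ne_zero_of_sum_ne_zero hwv
      have h1 := h w x (left_ne_zero_of_mul hx)
      have h2 := ih x v (right_ne_zero_of_mul hx)
      omega
  refine ⟨Finset.univ.sup ht + 1, ?_⟩
  ext w v
  by_contra h0
  have h1 := key _ w v h0
  have h2 := Finset.le_sup (f := ht) (Finset.mem_univ w)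
  omega

/-- A height of vertices that every matrix of `U_B` increases strictly: first the difference of the
distances to both ends of the row counts, then the index of the row, which is at most `n`. -/
def Vertex.height (v : Vertex P) : ℕ := (2 * v.pos + n - v.level) * (n + 1) + v.row

theorem mult_le (i : ℕ) : mult P i ≤ n := by
  have h1 : mult P i ≤ Multiset.card P.parts := Multiset.count_le_card _ _
  have h2 : Multiset.card P.parts ≤ P.parts.sum := by
    have := Multiset.card_nsmul_le_sum (s := P.parts) (a := 1) (fun x hx => P.parts_pos hx)
    simpa using this
  rw [P.parts_sum] at h2
  omega

theorem Vertex.height_lt {v w : Vertex P} (h1 : v.pos ≤ w.pos)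
    (h2 : w.level + v.pos ≤ v.level + w.pos)
    (h3 : w.pos = v.pos → w.level = v.level → v.row < w.row) : v.height < w.height := by
  have hv := v.bounds
  have hw := w.bounds
  have hv' := le_of_mem_supp v.level_mem
  have hw' := le_of_mem_supp w.level_mem
  have hm := mult_le (P := P) v.level
  rw [height, height]
  rcases Nat.lt_or_ge (2 * v.pos + n - v.level) (2 * w.pos + n - w.level) with h | h
  · have := Nat.mul_le_mul_right (n + 1) (Nat.succ_le_of_lt h)
    rw [Nat.succ_mul] at this
    omega
  · have h4 : w.pos = v.pos := by omega
    have h5 : w.level = v.level := by omega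
    have := h3 h4 h5
    rw [h4, h5]
    omega

theorem height_lt_of_mem_upperCommutator {A : Matrix (Vertex P) (Vertex P) K}
    (hA : A ∈ upperCommutator K P) {w v : Vertex P} (h : A w v ≠ 0) : v.height < w.height := by
  refine Vertex.height_lt (pos_le_of_commute hA.1 h) (level_le_of_commute hA.1 h) ?_
  intro h1 h2
  by_contra h3
  have hv := v.bounds
  have hw := w.bounds
  rw [apply_eq_of_commute hA.1 h1 h2
    (w' := Vertex.mk 1 w.level w.row (by omega)) (v' := Vertex.mk 1 w.level v.row (by rw [h2]; omega))
    rfl rfl rfl rfl rfl rfl] at h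
  exact h (hA.2 _ _ rfl rfl rfl (not_lt.1 h3))

theorem upperCommutator_subset : upperCommutator K P ⊆ nilCommutator K P := fun _ hA =>
  ⟨hA.1, isNilpotent_of_height Vertex.height fun _ _ => height_lt_of_mem_upperCommutator hA⟩

/-- The first vertex of the `k`-th row of length `i`, the rows being counted from `0`. -/
def firstVertex {i : ℕ} (hi : 1 ≤ i) (k : Fin (mult P i)) : Vertex P :=
  Vertex.mk 1 i (k + 1) (by have := k.2; omega)

/-- The matrix of coefficients of `A (1, i, k)` on `(1, i, k')`. -/
def diagBlock (A : Matrix (Vertex P) (Vertex P) K) {i : ℕ} (hi : 1 ≤ i) :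
    Matrix (Fin (mult P i)) (Fin (mult P i)) K :=
  A.submatrix (firstVertex hi) (firstVertex hi)

theorem firstVertex_injective {i : ℕ} (hi : 1 ≤ i) :
    Function.Injective (firstVertex (P := P) hi) := by
  intro k k' h
  have : (k : ℕ) + 1 = k' + 1 := congrArg Vertex.row h
  exact Fin.ext (by omega)

/-- On the commutator of `J_P`, taking diagonal blocks is multiplicative. -/
theorem diagBlock_mul {A A' : Matrix (Vertex P) (Vertex P) K} (hA : Commute A (jordanMatrix K P))
    (hA' : Commute A' (jordanMatrix K P)) {i : ℕ} (hi : 1 ≤ i) :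
    diagBlock (A * A') hi = diagBlock A hi * diagBlock A' hi := by
  ext k' k
  simp only [diagBlock, Matrix.submatrix_apply, Matrix.mul_apply]
  symm
  refine Fintype.sum_of_injective _ (firstVertex_injective hi) _ _ ?_ (fun _ => rfl)
  intro x hx
  by_contra h
  have h1 := left_ne_zero_of_mul h
  have h2 := right_ne_zero_of_mul h
  have p1 := pos_le_of_commute hA h1
  have p2 := level_le_of_commute hA h1
  have p4 := level_le_of_commute hA' h2
  have hxb := x.bounds
  change x.pos ≤ 1 at p1
  change i + x.pos ≤ x.level + 1 at p2
  change x.level + 1 ≤ i + x.pos at p4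
  have hl : x.level = i := by omega
  rw [hl] at hxb
  refine hx ⟨⟨x.row - 1, by omega⟩, Vertex.ext' ?_ hl.symm ?_⟩
  · change 1 = x.pos
    omega
  · change x.row - 1 + 1 = x.row
    omega

theorem diagBlock_one {i : ℕ} (hi : 1 ≤ i) :
    diagBlock (1 : Matrix (Vertex P) (Vertex P) K) hi = 1 :=
  Matrix.submatrix_one _ (firstVertex_injective hi)

theorem diagBlock_pow {A : Matrix (Vertex P) (Vertex P) K} (hA : Commute A (jordanMatrix K P))
    {i : ℕ} (hi : 1 ≤ i) (m : ℕ) : diagBlock (A ^ m) hi = diagBlock A hi ^ m := by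
  induction m with
  | zero => rw [pow_zero, pow_zero, diagBlock_one]
  | succ m ih => rw [pow_succ, pow_succ, diagBlock_mul (hA.pow_left m) hA, ih]

/-- The matrix acting on the rows of length `i` through the matrix `G i`, in each position. -/
def blockMatrix (G : ∀ i, Matrix (Fin (mult P i)) (Fin (mult P i)) K) :
    Matrix (Vertex P) (Vertex P) K :=
  Matrix.of fun w v => if h : w.pos = v.pos ∧ w.level = v.level then
    G v.level ⟨w.row - 1, by have := w.bounds; rw [h.2] at this; omega⟩
      ⟨v.row - 1, by have := v.bounds; omega⟩ else 0

theorem blockMatrix_commute (G : ∀ i, Matrix (Fin (mult P i)) (Fin (mult P i)) K) :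
    Commute (blockMatrix G) (jordanMatrix K P) := by
  ext w v
  rw [mul_jordanMatrix_apply, jordanMatrix_mul_apply]
  have hw := w.bounds
  have hv := v.bounds
  by_cases h1 : v.pos + 1 ≤ v.level <;> by_cases h2 : 1 < w.pos
  · rw [dif_pos h1, dif_pos h2, blockMatrix, Matrix.of_apply, Matrix.of_apply]
    by_cases h3 : w.pos = v.pos + 1 ∧ w.level = v.level
    · rw [dif_pos, dif_pos]
      · rfl
      · exact ⟨by change w.pos - 1 = v.pos; omega, h3.2⟩
      · exact h3
    · rw [dif_neg, dif_neg]
      · change ¬ (w.pos - 1 = v.pos ∧ w.level = v.level)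
        omega
      · exact h3
  · rw [dif_pos h1, dif_neg h2]
    refine dif_neg ?_
    change ¬ (w.pos = v.pos + 1 ∧ w.level = v.level)
    omega
  · rw [dif_neg h1, dif_pos h2]
    symm
    refine dif_neg ?_
    change ¬ (w.pos - 1 = v.pos ∧ w.level = v.level)
    omega
  · rw [dif_neg h1, dif_neg h2]

theorem diagBlock_blockMatrix (G : ∀ i, Matrix (Fin (mult P i)) (Fin (mult P i)) K) {i : ℕ}
    (hi : 1 ≤ i) : diagBlock (blockMatrix G) hi = G i := by
  ext k' k
  exact dif_pos ⟨rfl, rfl⟩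

theorem blockMatrix_mul (G H : ∀ i, Matrix (Fin (mult P i)) (Fin (mult P i)) K) :
    blockMatrix G * blockMatrix H = blockMatrix fun i => G i * H i := by
  ext w v
  have hv := v.bounds
  have hw := w.bounds
  by_cases h : w.pos = v.pos ∧ w.level = v.level
  · have hrow : w.row ≤ mult P v.level := by rw [← h.2]; exact hw.2.2
    rw [Matrix.mul_apply, show blockMatrix (fun i => G i * H i) w v = (G v.level * H v.level)
      ⟨w.row - 1, by omega⟩ ⟨v.row - 1, by omega⟩ from dif_pos h, Matrix.mul_apply]
    let f : Fin (mult P v.level) → Vertex P := fun k =>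
      Vertex.mk v.pos v.level (k + 1) (by have := k.2; omega)
    symm
    refine Fintype.sum_of_injective f ?_ _ _ ?_ ?_
    · intro k k' hk
      have : (k : ℕ) + 1 = k' + 1 := congrArg Vertex.row hk
      exact Fin.ext (by omega)
    · intro x hx
      by_contra h0
      have h2 := right_ne_zero_of_mul h0
      have h3 : x.pos = v.pos ∧ x.level = v.level := by
        by_contra h4
        exact h2 (dif_neg h4)
      have hxb := x.bounds
      rw [h3.2] at hxb
      refine hx ⟨⟨x.row - 1, by omega⟩, Vertex.ext' h3.1.symm h3.2.symm ?_⟩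
      change x.row - 1 + 1 = x.row
      omega
    · intro k
      rw [show blockMatrix G w (f k) = _ from dif_pos h,
        show blockMatrix H (f k) v = _ from dif_pos ⟨rfl, rfl⟩]
      rfl
  · rw [show blockMatrix (fun i => G i * H i) w v = 0 from dif_neg h, Matrix.mul_apply]
    refine Finset.sum_eq_zero fun x _ => ?_
    by_contra h0
    have h1 : w.pos = x.pos ∧ w.level = x.level := by
      by_contra h4
      exact left_ne_zero_of_mul h0 (dif_neg h4)
    have h3 : x.pos = v.pos ∧ x.level = v.level := by
      by_contra h4
      exact right_ne_zero_of_mul h0 (dif_neg h4)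
    omega

theorem blockMatrix_one :
    blockMatrix (fun i => (1 : Matrix (Fin (mult P i)) (Fin (mult P i)) K)) = 1 := by
  ext w v
  have hv := v.bounds
  have hw := w.bounds
  rw [blockMatrix, Matrix.of_apply, Matrix.one_apply]
  split_ifs with h h2 h2
  · subst h2
    exact Matrix.one_apply_eq _
  · refine Matrix.one_apply_ne fun h3 => h2 (Vertex.ext' h.1 h.2 ?_)
    have : w.row - 1 = v.row - 1 := congrArg Fin.val h3
    omega
  · subst h2
    exact absurd ⟨rfl, rfl⟩ h
  · rfl

theorem exists_conj_mem_upperCommutator {A : Matrix (Vertex P) (Vertex P) K}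
    (hA : A ∈ nilCommutator K P) :
    ∃ g h u : Matrix (Vertex P) (Vertex P) K, g * h = 1 ∧ h * g = 1 ∧
      Commute g (jordanMatrix K P) ∧ u ∈ upperCommutator K P ∧ A = g * u * h := by
  have hex : ∀ i, ∃ g h T : Matrix (Fin (mult P i)) (Fin (mult P i)) K, g * h = 1 ∧ h * g = 1 ∧
      ∀ hi : 1 ≤ i, diagBlock A hi * g = g * T ∧ ∀ k' k, k' ≤ k → T k' k = 0 := by
    intro i
    by_cases hi : 1 ≤ i
    · have hnil : IsNilpotent (diagBlock A hi) := by
        obtain ⟨N, hN⟩ := hA.2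
        exact ⟨N, by rw [← diagBlock_pow hA.1, hN]; rfl⟩
      obtain ⟨g, h, T, h1, h2, h3, h4⟩ := exists_strictly_triangular _ hnil
      exact ⟨g, h, T, h1, h2, fun _ => ⟨h3, h4⟩⟩
    · exact ⟨1, 1, 0, one_mul 1, one_mul 1, fun h => absurd h hi⟩
  choose g h T h1 h2 h3 using hex
  have hgh : blockMatrix g * blockMatrix h = 1 := by
    rw [blockMatrix_mul]
    simp only [h1]
    exact blockMatrix_one
  have hhg : blockMatrix h * blockMatrix g = 1 := by
    rw [blockMatrix_mul]
    simp only [h2]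
    exact blockMatrix_one
  refine ⟨blockMatrix g, blockMatrix h, blockMatrix h * A * blockMatrix g, hgh, hhg,
    blockMatrix_commute g, ⟨?_, ?_⟩, ?_⟩
  · exact ((blockMatrix_commute h).mul_left hA.1).mul_left (blockMatrix_commute g)
  · intro v w hv hw hl hr
    have hvb := v.bounds
    have hwb := w.bounds
    have hi : 1 ≤ v.level := by omega
    have hd : diagBlock (blockMatrix h * A * blockMatrix g) hi = T v.level := by
      rw [diagBlock_mul ((blockMatrix_commute h).mul_left hA.1) (blockMatrix_commute g),
        diagBlock_mul (blockMatrix_commute h) hA.1, diagBlock_blockMatrix, diagBlock_blockMatrix,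
        Matrix.mul_assoc, (h3 _ hi).1, ← Matrix.mul_assoc, h2, Matrix.one_mul]
    rw [hl] at hwb
    have hw' : firstVertex hi ⟨w.row - 1, by omega⟩ = w :=
      Vertex.ext' hw.symm hl.symm (by change w.row - 1 + 1 = w.row; omega)
    have hv' : firstVertex hi ⟨v.row - 1, by omega⟩ = v :=
      Vertex.ext' hv.symm rfl (by change v.row - 1 + 1 = v.row; omega)
    have h0 := (h3 _ hi).2 ⟨w.row - 1, by omega⟩ ⟨v.row - 1, by omega⟩ (by
      rw [Fin.le_def]
      change w.row - 1 ≤ v.row - 1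
      omega)
    rwa [← hd, diagBlock, Matrix.submatrix_apply, hw', hv'] at h0
  · rw [Matrix.mul_assoc, Matrix.mul_assoc, hgh, Matrix.mul_one, ← Matrix.mul_assoc, hgh,
      Matrix.one_mul]

end Oblak

/-! ### Irreducibility of the nilpotent commutator and the generic Jordan type -/

namespace Oblak
open Module

/-- The value of a polynomial in the matrix entries at a matrix. -/
noncomputable def evalAt {R V : Type*} [CommRing R] (f : MvPolynomial (V × V) R)
    (A : Matrix V V R) : R := MvPolynomial.eval (fun p => A p.1 p.2) f

theorem evalAt_mul {R V : Type*} [CommRing R] (f g : MvPolynomial (V × V) R) (A : Matrix V V R) :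
    evalAt (f * g) A = evalAt f A * evalAt g A := map_mul _ _ _

/-- The determinant with entry `(A ^ k j) (r i) (c j)` in row `i` and column `j`, as a polynomial
in the entries of `A`: the power of `A` may vary with the column. -/
noncomputable def powMinor (K : Type*) {V ι : Type*} [CommRing K] [Fintype V] [DecidableEq V] [Fintype ι]
    [DecidableEq ι] (k : ι → ℕ) (r c : ι → V) : MvPolynomial (V × V) K :=
  (Matrix.of fun i j => (Matrix.mvPolynomialX V V K ^ k j) (r i) (c j)).det

theorem aeval_powMinor {K S V ι : Type*} [CommRing K] [CommRing S] [Algebra K S] [Fintype V]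
    [DecidableEq V] [Fintype ι] [DecidableEq ι] (k : ι → ℕ) (r c : ι → V) (A : Matrix V V S) :
    MvPolynomial.aeval (fun p : V × V => A p.1 p.2) (powMinor K k r c) =
      (Matrix.of fun i j => (A ^ k j) (r i) (c j)).det := by
  rw [powMinor, AlgHom.map_det]
  congr 1
  ext i j
  have h := Matrix.mvPolynomialX_mapMatrix_aeval K A
  rw [AlgHom.mapMatrix_apply, Matrix.map_apply, Matrix.of_apply, Matrix.of_apply]
  conv_rhs => rw [← h, ← map_pow]
  rfl

theorem evalAt_powMinor {K V ι : Type*} [CommRing K] [Fintype V]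
    [DecidableEq V] [Fintype ι] [DecidableEq ι] (k : ι → ℕ) (r c : ι → V) (A : Matrix V V K) :
    evalAt (powMinor K k r c) A = (Matrix.of fun i j => (A ^ k j) (r i) (c j)).det := by
  refine Eq.trans ?_ (aeval_powMinor (K := K) (S := K) k r c A)
  rw [MvPolynomial.aeval_eq_eval]
  rfl

variable {K : Type*} [Field K] {n : ℕ} {P Q : n.Partition}

open Polynomial in
theorem eval_aeval_matrix {V : Type*} (f : MvPolynomial (V × V) K) (M : Matrix V V K[X]) (t : K) :
    (MvPolynomial.aeval (fun p : V × V => M p.1 p.2) f).eval t =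
      evalAt f (M.map (Polynomial.eval t)) := by
  rw [evalAt, ← Polynomial.coe_evalRingHom, MvPolynomial.map_aeval, ← MvPolynomial.eval₂_id]
  have : (Polynomial.evalRingHom t).comp (algebraMap K K[X]) = RingHom.id K := by
    ext a
    simp
  rw [this]
  rfl

theorem smul_mem_upperCommutator {u : Matrix (Vertex P) (Vertex P) K} (hu : u ∈ upperCommutator K P)
    (c : K) : c • u ∈ upperCommutator K P := by
  refine ⟨hu.1.smul_left c, fun v w h1 h2 h3 h4 => ?_⟩
  rw [Matrix.smul_apply, hu.2 v w h1 h2 h3 h4, smul_zero]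

theorem add_mem_upperCommutator {u u' : Matrix (Vertex P) (Vertex P) K}
    (hu : u ∈ upperCommutator K P) (hu' : u' ∈ upperCommutator K P) :
    u + u' ∈ upperCommutator K P := by
  refine ⟨hu.1.add_left hu'.1, fun v w h1 h2 h3 h4 => ?_⟩
  rw [Matrix.add_apply, hu.2 v w h1 h2 h3 h4, hu'.2 v w h1 h2 h3 h4, add_zero]

/-- The adjugate in place of the inverse makes the parametrization of `N_B` polynomial. -/
theorem exists_adjugate_conj {A : Matrix (Vertex P) (Vertex P) K} (hA : A ∈ nilCommutator K P) :
    ∃ g u : Matrix (Vertex P) (Vertex P) K, g.det ≠ 0 ∧ Commute g (jordanMatrix K P) ∧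
      u ∈ upperCommutator K P ∧ A = g * u * g.adjugate := by
  obtain ⟨g, h, u, h1, h2, h3, h4, h5⟩ := exists_conj_mem_upperCommutator hA
  have hdet : g.det ≠ 0 := by
    intro h0
    have := congrArg Matrix.det h1
    rw [Matrix.det_mul, h0, zero_mul, Matrix.det_one] at this
    exact zero_ne_one this
  refine ⟨g, g.det⁻¹ • u, hdet, h3, smul_mem_upperCommutator h4 _, ?_⟩
  have hadj : g.adjugate = g.det • h := by
    have := congrArg (· * h) (Matrix.adjugate_mul g)
    simp only [Matrix.mul_assoc, h1, Matrix.mul_one, Matrix.smul_mul, Matrix.one_mul] at this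
    exact this
  rw [h5, hadj, Matrix.mul_smul, Matrix.mul_smul, Matrix.smul_mul, smul_smul,
    mul_inv_cancel₀ hdet, one_smul]

theorem adjugate_conj_mem {g u : Matrix (Vertex P) (Vertex P) K} (hdet : g.det ≠ 0)
    (hg : Commute g (jordanMatrix K P)) (hu : u ∈ upperCommutator K P) :
    g * u * g.adjugate ∈ nilCommutator K P := by
  have hadj : Commute g.adjugate (jordanMatrix K P) := by
    have h1 : g.adjugate * (g * jordanMatrix K P) * g.adjugate =
        g.adjugate * (jordanMatrix K P * g) * g.adjugate := by rw [hg.eq]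
    rw [← Matrix.mul_assoc, Matrix.adjugate_mul, Matrix.mul_assoc, Matrix.mul_assoc,
      Matrix.mul_assoc, Matrix.mul_adjugate, Matrix.smul_mul, Matrix.one_mul, Matrix.mul_smul,
      Matrix.mul_smul, Matrix.mul_one] at h1
    exact (smul_right_injective _ hdet h1).symm
  refine ⟨(hg.mul_left hu.1).mul_left hadj, ?_⟩
  obtain ⟨N, hN⟩ := (upperCommutator_subset hu).2
  have hpow : ∀ m, (g * u * g.adjugate) ^ m * g = g.det ^ m • (g * u ^ m) := by
    intro m
    induction m with
    | zero => simp
    | succ m ih =>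
      rw [pow_succ', Matrix.mul_assoc, ih, Matrix.mul_smul, Matrix.mul_assoc,
        ← Matrix.mul_assoc g.adjugate, Matrix.adjugate_mul, Matrix.smul_mul, Matrix.one_mul,
        Matrix.mul_smul, smul_smul, ← pow_succ, Matrix.mul_assoc, ← pow_succ']
  refine ⟨N, ?_⟩
  have h := hpow N
  rw [hN, Matrix.mul_zero, smul_zero] at h
  have h2 := congrArg (· * g.adjugate) h
  simp only [Matrix.mul_assoc, Matrix.mul_adjugate, Matrix.zero_mul, Matrix.mul_smul,
    Matrix.mul_one] at h2
  simpa [hdet, Matrix.mul_assoc] using h2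

open Polynomial in
/-- Irreducibility of `N_B` as a property of polynomial functions on it. -/
theorem nilCommutator_irreducible [Infinite K] {f₁ f₂ : MvPolynomial (Vertex P × Vertex P) K}
    {A₁ A₂ : Matrix (Vertex P) (Vertex P) K} (h₁ : A₁ ∈ nilCommutator K P)
    (h₂ : A₂ ∈ nilCommutator K P) (hf₁ : evalAt f₁ A₁ ≠ 0) (hf₂ : evalAt f₂ A₂ ≠ 0) :
    ∃ A ∈ nilCommutator K P, evalAt (f₁ * f₂) A ≠ 0 := by
  obtain ⟨g₁, u₁, hd₁, hg₁, hu₁, rfl⟩ := exists_adjugate_conj h₁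
  obtain ⟨g₂, u₂, hd₂, hg₂, hu₂, rfl⟩ := exists_adjugate_conj h₂
  -- the line through two matrices, with its points for `X = 0` and `X = 1`
  let line : Matrix (Vertex P) (Vertex P) K → Matrix (Vertex P) (Vertex P) K →
      Matrix (Vertex P) (Vertex P) K[X] := fun a b => a.map C + (X : K[X]) • (b - a).map C
  have hline : ∀ a b t, (evalRingHom t).mapMatrix (line a b) = a + t • (b - a) := by
    intro a b t
    ext i j
    simp [line]
  let G := line g₁ g₂
  let M := G * line u₁ u₂ * G.adjugate
  have hM : ∀ t, M.map (eval t) = (g₁ + t • (g₂ - g₁)) * (u₁ + t • (u₂ - u₁)) *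
      (g₁ + t • (g₂ - g₁)).adjugate := by
    intro t
    change (evalRingHom t).mapMatrix M = _
    simp only [M, G, map_mul, RingHom.map_adjugate, hline]
  have hG : ∀ t, G.det.eval t = (g₁ + t • (g₂ - g₁)).det := by
    intro t
    rw [← coe_evalRingHom, RingHom.map_det, hline]
  let F : MvPolynomial (Vertex P × Vertex P) K → K[X] :=
    fun f => MvPolynomial.aeval (fun p => M p.1 p.2) f
  have hF : ∀ f t, (F f).eval t = evalAt f (M.map (eval t)) := fun f t => eval_aeval_matrix f M t
  have hne : ∀ {p : K[X]} (t : K), p.eval t ≠ 0 → p ≠ 0 := by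
    rintro p t h rfl
    exact h eval_zero
  have h0 : G.det * (F f₁ * F f₂) ≠ 0 := by
    refine mul_ne_zero (hne 0 ?_) (mul_ne_zero (hne 0 ?_) (hne 1 ?_))
    · rw [hG]; simpa using hd₁
    · rw [hF, hM]; simpa using hf₁
    · rw [hF, hM]; simpa using hf₂
  obtain ⟨t, ht⟩ := Polynomial.exists_eval_ne_zero_of_natDegree_lt_card _ h0
    ((Cardinal.natCast_lt_aleph0).trans_le (Cardinal.aleph0_le_mk K))
  rw [eval_mul, eval_mul, hG, hF, hF, ← evalAt_mul, hM] at ht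
  refine ⟨_, adjugate_conj_mem (left_ne_zero_of_mul ht) ?_ ?_, right_ne_zero_of_mul ht⟩
  · exact hg₁.add_left ((hg₂.sub_left hg₁).smul_left t)
  · have h3 : u₂ - u₁ = u₂ + (-1 : K) • u₁ := by rw [neg_one_smul, sub_eq_add_neg]
    rw [h3]
    exact add_mem_upperCommutator hu₁ (smul_mem_upperCommutator
      (add_mem_upperCommutator hu₂ (smul_mem_upperCommutator hu₁ _)) t)

theorem exists_evalAt_prod_ne_zero [Infinite K] {ι : Type*} (s : Finset ι)
    (f : ι → MvPolynomial (Vertex P × Vertex P) K)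
    (hf : ∀ i ∈ s, ∃ A ∈ nilCommutator K P, evalAt (f i) A ≠ 0) :
    ∃ A ∈ nilCommutator K P, evalAt (∏ i ∈ s, f i) A ≠ 0 := by
  classical
  induction s using Finset.induction_on with
  | empty =>
    refine ⟨0, ⟨Commute.zero_left _, IsNilpotent.zero⟩, ?_⟩
    rw [Finset.prod_empty, evalAt, map_one]
    exact one_ne_zero
  | insert a s ha ih =>
    obtain ⟨A₁, h₁, hf₁⟩ := hf a (Finset.mem_insert_self a s)
    obtain ⟨A₂, h₂, hf₂⟩ := ih fun i hi => hf i (Finset.mem_insert_of_mem hi)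
    rw [Finset.prod_insert ha]
    exact nilCommutator_irreducible h₁ h₂ hf₁ hf₂

theorem evalAt_eq_zero_of_dense {X D : Set (Matrix (Vertex P) (Vertex P) K)}
    (h : IsZariskiOpenDense X D) {f : MvPolynomial (Vertex P × Vertex P) K}
    (hf : ∀ A ∈ D, evalAt f A = 0) {A : Matrix (Vertex P) (Vertex P) K} (hA : A ∈ X) :
    evalAt f A = 0 := by
  have h1 : (fun p : Vertex P × Vertex P => A p.1 p.2) ∈ asPoints X := hA
  have h2 := h.2 h1
  rw [MvPolynomial.mem_zeroLocus_iff] at h2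
  refine h2 f ?_
  rw [MvPolynomial.mem_vanishingIdeal_iff]
  intro x hx
  exact hf _ hx

/-- A non-empty open set meets a dense one, so that some matrix has both Jordan types. -/
theorem IsGenericJordanType.unique {Q' : n.Partition} (h : IsGenericJordanType K P Q)
    (h' : IsGenericJordanType K P Q') : Q = Q' := by
  obtain ⟨D, hD, hQ⟩ := h
  obtain ⟨D', hD', hQ'⟩ := h'
  have h0 : (0 : Matrix (Vertex P) (Vertex P) K) ∈ nilCommutator K P :=
    ⟨Commute.zero_left _, IsNilpotent.zero⟩
  have hne : ∃ A, A ∈ D := by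
    by_contra! hno
    have := evalAt_eq_zero_of_dense hD (f := 1) (fun A hA => absurd hA (hno A)) h0
    rw [evalAt, map_one] at this
    exact one_ne_zero this
  obtain ⟨A, hA⟩ := hne
  obtain ⟨I, hI⟩ := hD.1
  have hA' : (fun p : Vertex P × Vertex P => A p.1 p.2) ∈ asPoints D := hA
  rw [hI] at hA'
  have h2 := hA'.2
  rw [MvPolynomial.mem_zeroLocus_iff] at h2
  push Not at h2
  obtain ⟨f, hfI, hf⟩ := h2
  have h3 : ∃ A' ∈ D', evalAt f A' ≠ 0 := by
    by_contra! hno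
    exact hf (evalAt_eq_zero_of_dense hD' hno hA'.1)
  obtain ⟨A', hA'D, hfA'⟩ := h3
  have h4 : (fun p : Vertex P × Vertex P => A' p.1 p.2) ∈ asPoints D := by
    rw [hI]
    obtain ⟨I', hI'⟩ := hD'.1
    have h5 : (fun p : Vertex P × Vertex P => A' p.1 p.2) ∈ asPoints D' := hA'D
    rw [hI'] at h5
    refine ⟨h5.1, fun h6 => ?_⟩
    rw [MvPolynomial.mem_zeroLocus_iff] at h6
    exact hfA' (h6 f hfI)
  exact (hQ _ h4).unique (hQ' _ hA'D)

theorem HasJordanType.eq_of_rank_pow_eq {A A' : Matrix (Vertex P) (Vertex P) K} {Q' : n.Partition}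
    (h : HasJordanType A Q) (h' : HasJordanType A' Q')
    (hr : ∀ k < n, (A ^ k).rank = (A' ^ k).rank) : Q = Q' := by
  have hr' : ∀ k, (jordanMatrix K Q ^ k).rank = (jordanMatrix K Q' ^ k).rank := by
    intro k
    rcases Nat.lt_or_ge k n with hk | hk
    · rw [← h.rank_pow, ← h'.rank_pow, hr k hk]
    · rw [pow_eq_zero_of_le hk jordanMatrix_pow_eq_zero,
        pow_eq_zero_of_le hk jordanMatrix_pow_eq_zero, Matrix.rank_zero, Matrix.rank_zero]
  apply eq_of_conj_eq
  intro m hm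
  obtain ⟨k, rfl⟩ : ∃ k, m = k + 1 := ⟨m - 1, by omega⟩
  have h1 := rank_jordanMatrix_pow_eq_add (K := K) (P := Q) k
  have h2 := rank_jordanMatrix_pow_eq_add (K := K) (P := Q') k
  have h3 := hr' k
  have h4 := hr' (k + 1)
  omega

/-- The generic Jordan type is the one for which all powers have maximal rank. -/
theorem exists_isGenericJordanType [Infinite K] (P : n.Partition) :
    ∃ Q : n.Partition, IsGenericJordanType K P Q := by
  classical
  have hmax : ∀ k, ∃ A ∈ nilCommutator K P, ∀ A' ∈ nilCommutator K P,
      (A' ^ k).rank ≤ (A ^ k).rank := by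
    intro k
    have hne : (nilCommutator K P).Nonempty := ⟨0, Commute.zero_left _, IsNilpotent.zero⟩
    have hfin : ((fun A => (A ^ k).rank) '' nilCommutator K P).Finite := by
      refine (Set.finite_Iic (Fintype.card (Vertex P))).subset ?_
      rintro _ ⟨A, -, rfl⟩
      exact Matrix.rank_le_card_width _
    obtain ⟨r, ⟨A, hA, rfl⟩, hr⟩ := hfin.exists_maximal (hne.image _)
    refine ⟨A, hA, fun A' hA' => ?_⟩
    rcases le_total (A' ^ k).rank (A ^ k).rank with h | h
    · exact h
    · exact hr ⟨A', hA', rfl⟩ h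
  choose A hA hAmax using hmax
  choose p q hpq using fun k => exists_submatrix_det_ne_zero (A k ^ k)
  let f : ℕ → MvPolynomial (Vertex P × Vertex P) K := fun k => powMinor K (fun _ => k) (p k) (q k)
  have hf : ∀ k (A' : Matrix (Vertex P) (Vertex P) K),
      evalAt (f k) A' = ((A' ^ k).submatrix (p k) (q k)).det := fun k A' => evalAt_powMinor _ _ _ _
  let F := ∏ k ∈ Finset.range n, f k
  obtain ⟨B, hB, hFB⟩ := exists_evalAt_prod_ne_zero (Finset.range n) f
    fun k _ => ⟨A k, hA k, by rw [hf]; exact hpq k⟩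
  have hrank : ∀ A' ∈ nilCommutator K P, evalAt F A' ≠ 0 → ∀ k < n,
      (A' ^ k).rank = (A k ^ k).rank := by
    intro A' hA' hF k hk
    refine le_antisymm (hAmax k A' hA') ?_
    apply le_rank_of_submatrix_det_ne_zero _ (p k) (q k)
    rw [← hf]
    rw [evalAt, map_prod] at hF
    exact (Finset.prod_ne_zero_iff.1 hF) k (Finset.mem_range.2 hk)
  obtain ⟨Q, hQ⟩ := exists_hasJordanType hB.2
  refine ⟨Q, {A' | A' ∈ nilCommutator K P ∧ evalAt F A' ≠ 0}, ⟨⟨Ideal.span {F}, ?_⟩, ?_⟩, ?_⟩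
  · ext x
    simp only [Set.mem_sdiff, MvPolynomial.zeroLocus_span]
    simp [asPoints, evalAt]
  · intro x hx
    rw [MvPolynomial.mem_zeroLocus_iff]
    intro g hg
    rw [MvPolynomial.mem_vanishingIdeal_iff] at hg
    by_contra h0
    obtain ⟨A', hA', h1⟩ := nilCommutator_irreducible (f₁ := F) (f₂ := g) hB hx hFB h0
    rw [evalAt_mul] at h1
    exact right_ne_zero_of_mul h1 (hg (fun p => A' p.1 p.2) ⟨hA', left_ne_zero_of_mul h1⟩)
  · rintro A' ⟨hA', hF⟩
    obtain ⟨Q', hQ'⟩ := exists_hasJordanType hA'.2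
    have : Q = Q' := hQ.eq_of_rank_pow_eq hQ' fun k hk => by
      rw [hrank B hB hFB k hk, hrank A' hA' hF k hk]
    rw [this]
    exact hQ'

end Oblak

/-! ### The potential of the vertices -/

namespace Oblak

section Potential

variable (A : Finset ℕ) (n : ℕ)

/-- The number of labels `b ∈ A` with `b ≤ i`. -/
def labelCount (i : ℕ) : ℕ := (A.filter fun b => b ≤ i).card

/-- A label `i` is wide if its chain, which occupies the positions from `c` to `i + 1 - c` of the
rows of length `i` when `i` is the `c`-th smallest label, covers at least two of them. Otherwise
`i = 2 * c - 1`, and the chain need not visit level `i - 1`. -/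
def IsWide (i : ℕ) : Prop := i ∈ A ∧ 2 * labelCount A i ≤ i

open Classical in
/-- The number of chains that descend to level `i` or lower. The chain of a wide label `b` reaches
down to level `b - 1`, that of another label `b` only to level `b`. -/
noncomputable def chainCount (i : ℕ) : ℕ := labelCount A i + if IsWide A (i + 1) then 1 else 0

open Classical in
/-- The maximal slope `κ i` of the potential at level `i`. It is the same on the two levels `i - 1`
and `i` if `i` is a wide label, and increases strictly otherwise. -/
noncomputable def slopeCap (i : ℕ) : ℕ := 2 * (if IsWide A i then i - 1 else i) + 2

/-- The slope `p v` of the potential at distance `v` from the ends of the rows. It is less than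
`κ i` if `v` is less than the number of chains at level `i`, and greater than `κ i` otherwise. -/
noncomputable def endSlope (v : ℕ) : ℕ :=
  2 * ((Finset.range (n + 1)).filter fun i => chainCount A i ≤ v).card + 1

/-- The slope of the potential between the positions `v` and `v + 1` of level `i`. The positions
`0` and `i + 1` beyond the ends of the row are included, so that reversal is `v ↦ i - v`. -/
noncomputable def slope (i v : ℕ) : ℕ :=
  min (min (endSlope A n v) (endSlope A n (i - v))) (slopeCap A i)

/-- The potential of the vertices in position `u` of level `i`. -/
noncomputable def potential (i u : ℕ) : ℕ := ∑ v ∈ Finset.range u, slope A n i v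

open Classical in
/-- The bound on the positions for which the potentials of the neighbouring levels `i < j` agree.
If they are the two levels of a wide label, then all positions agree but the last ones, where
chains ascend. Otherwise only the positions agree in which chains descend. -/
noncomputable def tightBound (i j : ℕ) : ℕ :=
  if IsWide A j ∧ j = i + 1 then j - chainCount A j else chainCount A i

variable {A n}

theorem labelCount_succ_of_notMem {i : ℕ} (h : i + 1 ∉ A) :
    labelCount A (i + 1) = labelCount A i := by
  rw [labelCount, labelCount]
  congr 1
  ext b
  simp only [Finset.mem_filter, and_congr_right_iff]
  intro hb
  have : b ≠ i + 1 := fun h0 => h (h0 ▸ hb)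
  omega

theorem labelCount_succ_of_mem {i : ℕ} (h : i + 1 ∈ A) :
    labelCount A (i + 1) = labelCount A i + 1 := by
  rw [labelCount, labelCount, ← Finset.card_insert_of_notMem (a := i + 1)]
  · congr 1
    ext b
    simp only [Finset.mem_filter, Finset.mem_insert]
    constructor
    · rintro ⟨hb, h1⟩
      by_cases h2 : b = i + 1
      · exact Or.inl h2
      · exact Or.inr ⟨hb, by omega⟩
    · rintro (rfl | ⟨hb, h1⟩)
      · exact ⟨h, le_rfl⟩
      · exact ⟨hb, by omega⟩
  · simp

theorem labelCount_mono {i j : ℕ} (h : i ≤ j) : labelCount A i ≤ labelCount A j :=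
  Finset.card_le_card fun b hb => by
    rw [Finset.mem_filter] at hb ⊢
    exact ⟨hb.1, hb.2.trans h⟩

variable (hpos : ∀ a ∈ A, 1 ≤ a) (hgap : ∀ a ∈ A, ∀ b ∈ A, a < b → a + 2 ≤ b)

include hpos hgap in
/-- Labels differ by at least two. -/
theorem two_mul_labelCount_le (i : ℕ) : 2 * labelCount A i ≤ i + 1 := by
  induction i using Nat.strong_induction_on with
  | _ i ih =>
    rcases i with _ | i
    · have : labelCount A 0 = 0 := by
        rw [labelCount, Finset.card_eq_zero, Finset.filter_eq_empty_iff]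
        intro b hb
        have := hpos b hb
        omega
      omega
    · by_cases h : i + 1 ∈ A
      · rw [labelCount_succ_of_mem h]
        rcases i with _ | i
        · have := ih 0 (by omega)
          omega
        · rw [labelCount_succ_of_notMem fun h0 => by have := hgap _ h0 _ h (by omega); omega]
          have := ih i (by omega)
          omega
      · rw [labelCount_succ_of_notMem h]
        have := ih i (by omega)
        omega

include hgap in
theorem not_isWide_succ {i : ℕ} (h : IsWide A i) : ¬ IsWide A (i + 1) := fun h' => by
  have := hgap _ h.1 _ h'.1 (by omega)
  omega

include hgap in
theorem chainCount_of_isWide {j : ℕ} (h : IsWide A j) : chainCount A j = labelCount A j := by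
  rw [chainCount, if_neg (not_isWide_succ hgap h), add_zero]

include hgap in
theorem chainCount_succ_of_isWide {i : ℕ} (h : IsWide A (i + 1)) :
    chainCount A (i + 1) = chainCount A i := by
  rw [chainCount_of_isWide hgap h, chainCount, if_pos h, labelCount_succ_of_mem h.1]

include hgap in
theorem chainCount_mono {i j : ℕ} (h : i ≤ j) : chainCount A i ≤ chainCount A j := by
  refine monotone_nat_of_le_succ (fun i => ?_) h
  by_cases hw : IsWide A (i + 1)
  · rw [chainCount_succ_of_isWide hgap hw]
  · rw [chainCount, if_neg hw, chainCount]
    have := labelCount_mono (A := A) (Nat.le_add_right i 1)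
    omega

include hpos hgap in
theorem two_mul_chainCount_le (i : ℕ) : 2 * chainCount A i ≤ i + 1 := by
  rw [chainCount]
  split_ifs with h
  · rw [← labelCount_succ_of_mem h.1]
    exact h.2
  · exact two_mul_labelCount_le hpos hgap i

theorem slopeCap_lt {i j : ℕ} (h : i < j) (h' : ¬ (IsWide A j ∧ j = i + 1)) :
    slopeCap A i < slopeCap A j := by
  rw [slopeCap, slopeCap]
  split_ifs with h1 h2 h2
  · have : j ≠ i + 1 := fun h0 => h' ⟨h2, h0⟩
    omega
  · omega
  · have : j ≠ i + 1 := fun h0 => h' ⟨h2, h0⟩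
    omega
  · omega

include hgap in
theorem slopeCap_succ_of_isWide {i : ℕ} (h : IsWide A (i + 1)) :
    slopeCap A (i + 1) = slopeCap A i := by
  rw [slopeCap, slopeCap, if_pos h, if_neg fun h0 => not_isWide_succ hgap h0 h]
  omega

include hgap in
theorem slopeCap_mono {i j : ℕ} (h : i ≤ j) : slopeCap A i ≤ slopeCap A j := by
  rcases h.eq_or_lt with rfl | h
  · exact le_rfl
  · by_cases h' : IsWide A j ∧ j = i + 1
    · obtain ⟨h1, rfl⟩ := h'
      exact (slopeCap_succ_of_isWide hgap h1).ge
    · exact (slopeCap_lt h h').le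

theorem endSlope_mono {v w : ℕ} (h : v ≤ w) : endSlope A n v ≤ endSlope A n w := by
  have : ((Finset.range (n + 1)).filter fun i => chainCount A i ≤ v).card ≤
      ((Finset.range (n + 1)).filter fun i => chainCount A i ≤ w).card :=
    Finset.card_le_card fun i hi => by
      rw [Finset.mem_filter] at hi ⊢
      exact ⟨hi.1, hi.2.trans h⟩
  rw [endSlope, endSlope]
  omega

include hgap in
theorem slopeCap_lt_endSlope {i v : ℕ} (hi : i ≤ n) (h : chainCount A i ≤ v) :
    slopeCap A i < endSlope A n v := by
  have : (Finset.range (i + 1)).card ≤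
      ((Finset.range (n + 1)).filter fun i => chainCount A i ≤ v).card :=
    Finset.card_le_card fun j hj => by
      rw [Finset.mem_filter]
      rw [Finset.mem_range] at hj ⊢
      exact ⟨by omega, (chainCount_mono hgap (by omega)).trans h⟩
  rw [Finset.card_range] at this
  rw [endSlope, slopeCap]
  split_ifs <;> omega

include hgap in
theorem endSlope_lt_slopeCap {i v : ℕ} (h : v < chainCount A i) :
    endSlope A n v < slopeCap A i := by
  have key : ∀ j, v < chainCount A j →
      ((Finset.range (n + 1)).filter fun i => chainCount A i ≤ v).card ≤ j := by
    intro j hj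
    rw [← Finset.card_range j]
    refine Finset.card_le_card fun k hk => ?_
    rw [Finset.mem_filter] at hk
    rw [Finset.mem_range]
    by_contra h0
    have := chainCount_mono hgap (not_lt.1 h0)
    omega
  rw [endSlope, slopeCap]
  split_ifs with hw
  · rcases i with _ | i
    · have := key 0 h
      omega
    · have := key i (by rw [← chainCount_succ_of_isWide hgap hw]; exact h)
      omega
  · have := key i h
    omega

include hgap in
theorem slope_mono {i j : ℕ} (h : i ≤ j) (v : ℕ) : slope A n i v ≤ slope A n j v := by
  have := endSlope_mono (A := A) (n := n) (show i - v ≤ j - v by omega)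
  have := slopeCap_mono hgap h
  rw [slope, slope]
  omega

include hpos hgap in
theorem slope_eq {i j v : ℕ} (h : i < j) (hj : j ≤ n) (hv : v < tightBound A i j) :
    slope A n i v = slope A n j v := by
  rw [tightBound] at hv
  have hc := two_mul_chainCount_le hpos hgap i
  split_ifs at hv with hw
  · obtain ⟨hw, rfl⟩ := hw
    have h1 := chainCount_succ_of_isWide hgap hw
    have h2 := slopeCap_succ_of_isWide hgap hw
    have h3 := slopeCap_lt_endSlope hgap (n := n) (i := i) (v := i - v) (by omega) (by omega)
    have h4 := endSlope_mono (A := A) (n := n) (show i - v ≤ i + 1 - v by omega)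
    rw [slope, slope]
    omega
  · have h1 := endSlope_lt_slopeCap hgap (n := n) hv
    have h2 := slopeCap_mono hgap h.le
    have h3 := endSlope_mono (A := A) (n := n) (show v ≤ i - v by omega)
    have h4 := endSlope_mono (A := A) (n := n) (show v ≤ j - v by omega)
    rw [slope, slope]
    omega

include hpos hgap in
theorem slope_lt {i j : ℕ} (hi : 1 ≤ i) (h : i < j) (hj : j ≤ n) :
    slope A n i (tightBound A i j) < slope A n j (tightBound A i j) := by
  have hc := two_mul_chainCount_le hpos hgap i
  rw [tightBound]
  split_ifs with hw
  · obtain ⟨hw, rfl⟩ := hw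
    have h1 := chainCount_succ_of_isWide hgap hw
    have h0 := chainCount_of_isWide hgap hw
    have h5 := hw.2
    have h6 := labelCount_succ_of_mem hw.1
    have h2 := slopeCap_succ_of_isWide hgap hw
    have h3 := endSlope_lt_slopeCap hgap (n := n) (i := i)
      (v := i - (i + 1 - chainCount A (i + 1))) (by omega)
    have h4 := slopeCap_lt_endSlope hgap (n := n) (i := i + 1)
      (v := i + 1 - chainCount A (i + 1)) (by omega) (by omega)
    have h7 := slopeCap_lt_endSlope hgap (n := n) (i := i + 1)
      (v := i + 1 - (i + 1 - chainCount A (i + 1))) (by omega) (by omega)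
    rw [slope, slope]
    omega
  · have h1 := slopeCap_lt h hw
    have h2 : chainCount A i ≤ j - chainCount A i := by omega
    have h3 := slopeCap_lt_endSlope hgap (n := n) (i := i) (by omega) le_rfl
    have h4 := slopeCap_lt_endSlope hgap (n := n) (i := i) (by omega) h2
    rw [slope, slope]
    omega

include hgap in
theorem potential_mono {i j : ℕ} (h : i ≤ j) (u : ℕ) : potential A n i u ≤ potential A n j u :=
  Finset.sum_le_sum fun v _ => slope_mono hgap h v

include hpos hgap in
/-- The potentials of two levels agree exactly in the positions up to the tight bound. -/
theorem potential_eq_iff {i j u : ℕ} (hi : 1 ≤ i) (h : i < j) (hj : j ≤ n) :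
    potential A n i u = potential A n j u ↔ u ≤ tightBound A i j := by
  constructor
  · intro h1
    by_contra h2
    exact (Finset.sum_lt_sum (fun v _ => slope_mono hgap h.le v)
      ⟨_, Finset.mem_range.2 (not_le.1 h2), slope_lt hpos hgap hi h hj⟩).ne h1
  · intro h1
    exact Finset.sum_congr rfl fun v hv =>
      slope_eq hpos hgap h hj ((Finset.mem_range.1 hv).trans_le h1)

/-- The slopes of a level are symmetric under reversing its rows. -/
theorem potential_add {i u : ℕ} (h : u ≤ i + 1) :
    potential A n i u + potential A n i (i + 1 - u) = potential A n i (i + 1) := by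
  have h1 : potential A n i (i + 1) = potential A n i u +
      ∑ v ∈ Finset.range (i + 1 - u), slope A n i (u + v) := by
    rw [potential, potential, ← Finset.sum_range_add, Nat.add_sub_cancel' h]
  rw [h1, potential, potential, ← Finset.sum_range_reflect (fun v => slope A n i (u + v))]
  congr 1
  refine Finset.sum_congr rfl fun v hv => ?_
  rw [Finset.mem_range] at hv
  have h2 : u + (i + 1 - u - 1 - v) = i - v := by omega
  have h3 : i - (i - v) = v := by omega
  rw [h2, slope, slope, h3, min_comm (endSlope A n v)]

include hgap in
/-- By reversal of the rows, an `α` at position `u` corresponds to a `β` at `i + 1 - u`. -/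
theorem potential_alpha_le {i j u : ℕ} (h : i < j) (hu : u ≤ i) :
    potential A n j (u + j - i) ≤
      potential A n i u + (potential A n j (j + 1) - potential A n i (i + 1)) := by
  have h1 := potential_add (A := A) (n := n) (show u ≤ i + 1 by omega)
  have h2 := potential_add (A := A) (n := n) (show u + j - i ≤ j + 1 by omega)
  have h3 := potential_mono (n := n) hgap h.le (i + 1 - u)
  rw [show j + 1 - (u + j - i) = i + 1 - u by omega] at h2
  omega

include hpos hgap in
theorem potential_alpha_eq_iff {i j u : ℕ} (hi : 1 ≤ i) (h : i < j) (hj : j ≤ n) (hu : u ≤ i) :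
    potential A n j (u + j - i) =
      potential A n i u + (potential A n j (j + 1) - potential A n i (i + 1)) ↔
      i + 1 - u ≤ tightBound A i j := by
  have h1 := potential_add (A := A) (n := n) (show u ≤ i + 1 by omega)
  have h2 := potential_add (A := A) (n := n) (show u + j - i ≤ j + 1 by omega)
  have h3 := potential_mono (n := n) hgap h.le (i + 1 - u)
  have h4 := potential_mono (n := n) hgap h.le (i + 1)
  have h5 : potential A n j (i + 1) ≤ potential A n j (j + 1) :=
    Finset.sum_le_sum_of_subset (Finset.range_mono (by omega))
  rw [← potential_eq_iff hpos hgap hi h hj]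
  rw [show j + 1 - (u + j - i) = i + 1 - u by omega] at h2
  omega

theorem potential_succ (i u : ℕ) :
    potential A n i (u + 1) = potential A n i u + slope A n i u := Finset.sum_range_succ _ _

theorem slope_le (i u : ℕ) : slope A n i u ≤ slopeCap A i := min_le_right _ _

include hgap in
theorem slope_eq_slopeCap_iff {j u : ℕ} (hj : j ≤ n) (hu : u ≤ j) :
    slope A n j u = slopeCap A j ↔ chainCount A j ≤ u ∧ u + chainCount A j ≤ j := by
  constructor
  · intro h
    rw [slope] at h
    constructor
    · by_contra h0
      have := endSlope_lt_slopeCap hgap (n := n) (not_le.1 h0)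
      omega
    · by_contra h0
      have := endSlope_lt_slopeCap hgap (n := n) (i := j) (v := j - u) (by omega)
      omega
  · rintro ⟨h1, h2⟩
    have h3 := slopeCap_lt_endSlope hgap hj h1
    have h4 := slopeCap_lt_endSlope hgap (v := j - u) hj (by omega)
    rw [slope]
    omega

end Potential
end Oblak

/-! ### Elementary maps and tight maps -/

namespace Oblak
open Module

variable {K : Type*} [Field K] {n : ℕ} {P Q : n.Partition}

theorem prev_spec {i : ℕ} (hi : i ∈ nonMin P) :
    prev P i ∈ supp P ∧ prev P i < i ∧ ∀ j ∈ supp P, j < i → j ≤ prev P i := by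
  obtain ⟨-, j, hj, hji⟩ := Finset.mem_filter.1 hi
  have hne : ((supp P).filter fun s => s < i).Nonempty := ⟨j, Finset.mem_filter.2 ⟨hj, hji⟩⟩
  obtain ⟨m, hm, hmi⟩ := Finset.exists_mem_eq_sup _ hne id
  rw [Finset.mem_filter] at hm
  have hp : prev P i = m := hmi
  refine ⟨hp ▸ hm.1, hp ▸ hm.2, fun k hk hki => ?_⟩
  exact Finset.le_sup (f := id) (Finset.mem_filter.2 ⟨hk, hki⟩)

theorem prev_eq {i j : ℕ} (hj : j ∈ nonMin P) (hi : i ∈ supp P) (hij : i < j)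
    (h : ∀ k ∈ supp P, k < j → k ≤ i) : prev P j = i := by
  obtain ⟨h1, h2, h3⟩ := prev_spec hj
  exact le_antisymm (h _ h1 h2) (h3 i hi hij)

theorem mem_nonMin {i j : ℕ} (hi : i ∈ supp P) (hj : j ∈ supp P) (h : j < i) : i ∈ nonMin P :=
  Finset.mem_filter.2 ⟨hi, j, hj, h⟩

theorem exists_prev_eq {i k : ℕ} (hi : i ∈ supp P) (hk : k ∈ supp P) (h : i < k) :
    ∃ j ∈ nonMin P, prev P j = i := by
  have hne : ((supp P).filter fun s => i < s).Nonempty := ⟨k, Finset.mem_filter.2 ⟨hk, h⟩⟩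
  have hmem := Finset.min'_mem _ hne
  set j := ((supp P).filter fun s => i < s).min' hne with hj
  rw [Finset.mem_filter] at hmem
  have hjn := mem_nonMin hmem.1 hi hmem.2
  refine ⟨j, hjn, prev_eq hjn hi hmem.2 fun l hl hlj => ?_⟩
  by_contra h0
  have : j ≤ l := Finset.min'_le _ l (Finset.mem_filter.2 ⟨hl, not_le.1 h0⟩)
  omega

theorem pos_of_mem_supp {i : ℕ} (hi : i ∈ supp P) : 1 ≤ i :=
  P.parts_pos (Multiset.mem_toFinset.1 hi)

/-- The elementary maps: each sends the vertices of one row to the vertices of another,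
`(u, i, k)` to `(u', i', k')` where `u' + back = u + fwd`. -/
structure Arrow where
  /-- The level of the source row. -/
  srcLevel : ℕ
  /-- The index of the source row. -/
  srcRow : ℕ
  /-- The level of the target row. -/
  tgtLevel : ℕ
  /-- The index of the target row. -/
  tgtRow : ℕ
  /-- The number of steps backward. -/
  back : ℕ
  /-- The number of steps forward. -/
  fwd : ℕ

/-- `a` maps the basis vector `v` to the basis vector `w`. -/
abbrev Arrow.Maps (a : Arrow) (v w : Vertex P) : Prop :=
  (v.level = a.srcLevel ∧ v.row = a.srcRow) ∧
    (w.pos + a.back = v.pos + a.fwd ∧ w.level = a.tgtLevel ∧ w.row = a.tgtRow)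

/-- Indices for the maps `β_i`, `α_i`, `e_{i,k}` and `w_l`, in this order. -/
abbrev ArrowIndex : Type := (ℕ ⊕ ℕ) ⊕ ((Σ _ : ℕ, ℕ) ⊕ ℕ)

/-- The elementary map with a given index. -/
def arrow (P : n.Partition) : ArrowIndex → Arrow
  | .inl (.inl i) => ⟨i, mult P i, prev P i, 1, 0, 0⟩
  | .inl (.inr i) => ⟨prev P i, mult P (prev P i), i, 1, prev P i, i⟩
  | .inr (.inl x) => ⟨x.1, x.2, x.1, x.2 + 1, 0, 0⟩
  | .inr (.inr l) => ⟨l, mult P l, l, 1, 0, 1⟩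

/-- The indices of the maps that occur in an adequate matrix. -/
def arrowIndices (P : n.Partition) : Finset ArrowIndex :=
  ((nonMin P).disjSum (nonMin P)).disjSum
    (((supp P).sigma fun i => Finset.Ico 1 (mult P i)).disjSum (oddMin P))

/-- The matrix of an elementary map. -/
def arrowMatrix (R : Type*) [CommRing R] (P : n.Partition) (a : ArrowIndex) :
    Matrix (Vertex P) (Vertex P) R :=
  Matrix.of fun w v => if (arrow P a).Maps v w then 1 else 0

/-- The linear combination of the elementary maps with coefficients `x`. -/
def arrowSum {R : Type*} [CommRing R] (P : n.Partition) (x : ArrowIndex → R) :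
    Matrix (Vertex P) (Vertex P) R := ∑ a ∈ arrowIndices P, x a • arrowMatrix R P a

/-- The inequalities that make an elementary map commute with `J_P` and belong to `U_B`. -/
theorem arrow_height_data {a : ArrowIndex} (ha : a ∈ arrowIndices P) :
    (arrow P a).back ≤ (arrow P a).fwd ∧
      (arrow P a).tgtLevel + (arrow P a).back ≤ (arrow P a).srcLevel + (arrow P a).fwd ∧
      ((arrow P a).back = (arrow P a).fwd → (arrow P a).srcLevel = (arrow P a).tgtLevel →
        (arrow P a).srcRow < (arrow P a).tgtRow) := by
  rcases a with (i | i) | (⟨i, k⟩ | l)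
  · have hi : i ∈ nonMin P := by simpa [arrowIndices] using ha
    have := prev_spec hi
    simp only [arrow]
    omega
  · have hi : i ∈ nonMin P := by simpa [arrowIndices] using ha
    have := prev_spec hi
    simp only [arrow]
    omega
  · simp only [arrow]
    omega
  · simp only [arrow]
    omega

theorem arrowMatrix_mem {a : ArrowIndex} (ha : a ∈ arrowIndices P) :
    arrowMatrix K P a ∈ upperCommutator K P := by
  obtain ⟨h1, h2, h3⟩ := arrow_height_data ha
  constructor
  · ext w v
    rw [mul_jordanMatrix_apply, jordanMatrix_mul_apply]
    have hw := w.bounds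
    have hv := v.bounds
    have hzero : ∀ w v : Vertex P, ¬ (arrow P a).Maps v w → arrowMatrix K P a w v = 0 :=
      fun w v h => if_neg h
    split_ifs with h4 h5 h5
    · refine if_congr ?_ rfl rfl
      change ((v.level = _ ∧ v.row = _) ∧ (w.pos + _ = v.pos + 1 + _ ∧ w.level = _ ∧ w.row = _)) ↔
        ((v.level = _ ∧ v.row = _) ∧ (w.pos - 1 + _ = v.pos + _ ∧ w.level = _ ∧ w.row = _))
      omega
    · refine hzero _ _ ?_
      change ¬ ((v.level = _ ∧ v.row = _) ∧
        (w.pos + _ = v.pos + 1 + _ ∧ w.level = _ ∧ w.row = _))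
      omega
    · symm
      refine hzero _ _ ?_
      change ¬ ((v.level = _ ∧ v.row = _) ∧
        (w.pos - 1 + _ = v.pos + _ ∧ w.level = _ ∧ w.row = _))
      omega
    · rfl
  · intro v w hv hw hl hr
    refine if_neg ?_
    rintro ⟨⟨h4, h5⟩, h6, h7, h8⟩
    have := h3 (by omega) (by omega)
    omega

theorem height_lt_of_maps {a : ArrowIndex} (ha : a ∈ arrowIndices P) {v w : Vertex P}
    (h : (arrow P a).Maps v w) : v.height < w.height := by
  apply height_lt_of_mem_upperCommutator (arrowMatrix_mem (K := ℚ) ha)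
  rw [arrowMatrix, Matrix.of_apply, if_pos h]
  exact one_ne_zero

theorem arrowSum_mem (x : ArrowIndex → K) : arrowSum P x ∈ upperCommutator K P := by
  classical
  unfold arrowSum
  refine Finset.sum_induction _ (· ∈ upperCommutator K P)
    (fun _ _ h h' => add_mem_upperCommutator h h') ⟨Commute.zero_left _, fun _ _ _ _ _ _ => rfl⟩
    fun a ha => smul_mem_upperCommutator (arrowMatrix_mem ha) _

theorem arrowSum_isAdequate {x : ArrowIndex → K} (hx : ∀ a ∈ arrowIndices P, x a ≠ 0) :
    IsAdequate (arrowSum P x) := by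
  refine ⟨arrowSum_mem x, fun i => x (.inl (.inl i)), fun i => x (.inl (.inr i)),
    fun i k => x (.inr (.inl ⟨i, k⟩)), fun l => x (.inr (.inr l)), ?_, ?_, ?_, ?_⟩
  · intro i hi
    exact ⟨hx _ (by simpa [arrowIndices] using hi), hx _ (by simpa [arrowIndices] using hi)⟩
  · intro i hi k hk
    refine hx _ ?_
    rw [Finset.mem_Ico] at hk
    simpa [arrowIndices] using ⟨hi, hk⟩
  · intro l hl
    exact hx _ (by simpa [arrowIndices] using hl)
  · rw [arrowSum, arrowIndices, Finset.sum_disjSum, Finset.sum_disjSum, Finset.sum_disjSum,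
      Finset.sum_sigma, Finset.sum_add_distrib, ← add_assoc]
    rfl

section Tight

variable {A : Finset ℕ} (hA : A ⊆ supp P)
  (hgap : ∀ a ∈ A, ∀ b ∈ A, a < b → a + 2 ≤ b)

/-- The potential of a vertex. -/
noncomputable def Vertex.potential (A : Finset ℕ) (v : Vertex P) : ℕ :=
  Oblak.potential A n v.level v.pos

open Classical in
/-- The weights of the elementary maps, the exponents of their coefficients. The maps `α` have the
least weight that the potential allows. So do the maps `w` at wide labels; the others, which the
chains do not use, must not become tight. -/
noncomputable def weight (P : n.Partition) (A : Finset ℕ) : ArrowIndex → ℕ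
  | .inl (.inl _) => 0
  | .inl (.inr i) => potential A n i (i + 1) - potential A n (prev P i) (prev P i + 1)
  | .inr (.inl _) => 0
  | .inr (.inr l) => if IsWide A l then slopeCap A l else slopeCap A l + 1

/-- `a` maps `v` to `w`, and its weight is the difference of their potentials. -/
def Tight (A : Finset ℕ) (a : ArrowIndex) (v w : Vertex P) : Prop :=
  (arrow P a).Maps v w ∧ w.potential A = v.potential A + weight P A a

include hgap in
theorem potential_le_of_maps {a : ArrowIndex} (ha : a ∈ arrowIndices P) {v w : Vertex P}
    (h : (arrow P a).Maps v w) : w.potential A ≤ v.potential A + weight P A a := by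
  have hv := v.bounds
  have hw := w.bounds
  rcases a with (i | i) | (⟨i, k⟩ | l) <;> simp only [arrow, Arrow.Maps] at h <;>
    obtain ⟨⟨h1, h2⟩, h3, h4, h5⟩ := h <;> rw [Vertex.potential, Vertex.potential, h1, h4, weight]
  · have hi : i ∈ nonMin P := by simpa [arrowIndices] using ha
    rw [show w.pos = v.pos from h3]
    exact potential_mono hgap (prev_spec hi).2.1.le _
  · have hi : i ∈ nonMin P := by simpa [arrowIndices] using ha
    rw [show w.pos = v.pos + i - prev P i by omega]
    exact potential_alpha_le hgap (prev_spec hi).2.1 (by omega)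
  · rw [show w.pos = v.pos from h3]
    exact le_rfl
  · rw [show w.pos = v.pos + 1 from h3, potential_succ]
    have := slope_le (A := A) (n := n) l v.pos
    split_ifs <;> omega

include hA hgap in
theorem tight_beta_iff {i : ℕ} (hi : i ∈ nonMin P) {v w : Vertex P}
    (h : (arrow P (.inl (.inl i))).Maps v w) :
    Tight A (.inl (.inl i)) v w ↔ v.pos ≤ tightBound A (prev P i) i := by
  have hp := prev_spec hi
  rw [Tight, and_iff_right h]
  simp only [arrow, Arrow.Maps] at h
  obtain ⟨⟨h1, h2⟩, h3, h4, h5⟩ := h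
  rw [Vertex.potential, Vertex.potential, h1, h4, weight, show w.pos = v.pos from h3, add_zero]
  exact potential_eq_iff (fun a ha => pos_of_mem_supp (hA ha)) hgap (pos_of_mem_supp hp.1) hp.2.1
    (le_of_mem_supp (Finset.mem_filter.1 hi).1)

include hA hgap in
theorem tight_alpha_iff {i : ℕ} (hi : i ∈ nonMin P) {v w : Vertex P}
    (h : (arrow P (.inl (.inr i))).Maps v w) :
    Tight A (.inl (.inr i)) v w ↔ prev P i + 1 - v.pos ≤ tightBound A (prev P i) i := by
  have hp := prev_spec hi
  have hv := v.bounds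
  rw [Tight, and_iff_right h]
  simp only [arrow, Arrow.Maps] at h
  obtain ⟨⟨h1, h2⟩, h3, h4, h5⟩ := h
  rw [Vertex.potential, Vertex.potential, h1, h4, weight,
    show w.pos = v.pos + i - prev P i by omega]
  exact potential_alpha_eq_iff (fun a ha => pos_of_mem_supp (hA ha)) hgap (pos_of_mem_supp hp.1)
    hp.2.1 (le_of_mem_supp (Finset.mem_filter.1 hi).1) (by omega)

include hgap in
theorem tight_w_iff {l : ℕ} {v w : Vertex P} (h : (arrow P (.inr (.inr l))).Maps v w) :
    Tight A (.inr (.inr l)) v w ↔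
      IsWide A l ∧ chainCount A l ≤ v.pos ∧ v.pos + chainCount A l ≤ l := by
  have hv := v.bounds
  have hl := le_of_mem_supp v.level_mem
  rw [Tight, and_iff_right h]
  simp only [arrow, Arrow.Maps] at h
  obtain ⟨⟨h1, h2⟩, h3, h4, h5⟩ := h
  rw [Vertex.potential, Vertex.potential, h1, h4, weight, show w.pos = v.pos + 1 from h3,
    potential_succ, ← slope_eq_slopeCap_iff (n := n) (j := l) (u := v.pos) hgap (by omega) (by omega)]
  have := slope_le (A := A) (n := n) l v.pos
  split_ifs with hw
  · rw [and_iff_right hw]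
    omega
  · rw [iff_false_right (fun h0 => hw h0.1)]
    omega

theorem tight_e {i k : ℕ} {v w : Vertex P} (h : (arrow P (.inr (.inl ⟨i, k⟩))).Maps v w) :
    Tight A (.inr (.inl ⟨i, k⟩)) v w := by
  refine ⟨h, ?_⟩
  simp only [arrow, Arrow.Maps] at h
  obtain ⟨⟨h1, h2⟩, h3, h4, h5⟩ := h
  rw [Vertex.potential, Vertex.potential, h1, h4, weight, show w.pos = v.pos from h3, add_zero]

/-- A wide label `i + 1` is counted by `chainCount A i`, and is still at most `j`. -/
theorem chainCount_le_labelCount {i j : ℕ} (h : i < j) : chainCount A i ≤ labelCount A j := by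
  rw [chainCount]
  split_ifs with hw
  · rw [← labelCount_succ_of_mem hw.1]
    exact labelCount_mono h
  · exact labelCount_mono h.le

include hA hgap in
/-- At a level `i` between its neighbours `h` and `j`, no position has both a tight `β` to `h` and
a tight `α` to `j`. -/
theorem not_tight_beta_alpha {h i j u : ℕ} (hhi : h < i) (hij : i < j) (hu : 1 ≤ u ∧ u ≤ i)
    (hb : u ≤ tightBound A h i) (ha : i + 1 - u ≤ tightBound A i j) : False := by
  have hpos : ∀ a ∈ A, 1 ≤ a := fun a ha => pos_of_mem_supp (hA ha)
  have c1 := two_mul_chainCount_le hpos hgap h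
  have c2 := two_mul_chainCount_le hpos hgap i
  have c3 := two_mul_chainCount_le hpos hgap j
  have c4 := chainCount_le_labelCount (A := A) hhi
  have c5 := chainCount_mono hgap hhi.le
  rw [tightBound] at ha hb
  split_ifs at ha hb with hw hw' hw'
  · obtain ⟨hw, rfl⟩ := hw
    exact not_isWide_succ hgap hw'.1 hw
  · obtain ⟨hw, rfl⟩ := hw
    have c6 := chainCount_succ_of_isWide hgap hw
    have c7 : chainCount A i = labelCount A i + 1 := by rw [chainCount, if_pos hw]
    omega
  · omega
  · omega

include hgap in
theorem not_tight_beta_w {h i u : ℕ} (hhi : h + 1 < i) (hw : IsWide A i)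
    (hb : u ≤ tightBound A h i) (hc : chainCount A i ≤ u) : False := by
  obtain ⟨i, rfl⟩ : ∃ k, i = k + 1 := ⟨i - 1, by omega⟩
  have c1 := chainCount_le_labelCount (A := A) (show h < i by omega)
  have c2 := labelCount_succ_of_mem hw.1
  have c3 := chainCount_of_isWide hgap hw
  rw [tightBound, if_neg (by omega)] at hb
  omega

include hgap in
theorem not_tight_alpha_w {i j u : ℕ} (hw : IsWide A i)
    (ha : i + 1 - u ≤ tightBound A i j) (hc : u + chainCount A i ≤ i) : False := by
  rw [tightBound, if_neg (fun h : IsWide A j ∧ j = i + 1 => not_isWide_succ hgap hw (h.2 ▸ h.1))] at ha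
  omega

theorem prev_injective {i j : ℕ} (hi : i ∈ nonMin P) (hj : j ∈ nonMin P)
    (h : prev P i = prev P j) : i = j := by
  have h1 := prev_spec hi
  have h2 := prev_spec hj
  rcases lt_trichotomy i j with h3 | h3 | h3
  · have := h2.2.2 i (Finset.mem_filter.1 hi).1 h3
    omega
  · exact h3
  · have := h1.2.2 j (Finset.mem_filter.1 hj).1 h3
    omega

theorem prev_add_one_lt {l : ℕ} (hl : l ∈ nonMin P) (h : l - 1 ∉ supp P) : prev P l + 1 < l := by
  have h1 := prev_spec hl
  have h2 : prev P l ≠ l - 1 := fun h0 => h (h0 ▸ h1.1)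
  omega

theorem sub_one_notMem_of_mem_oddMin {l : ℕ} (h : l ∈ oddMin P) : l - 1 ∉ supp P := by
  obtain ⟨-, b, -, -, h1, -⟩ := Finset.mem_filter.1 h
  exact h1

include hA hgap in
/-- At most one tight map leaves a vertex. -/
theorem Tight.unique {a a' : ArrowIndex} (ha : a ∈ arrowIndices P) (ha' : a' ∈ arrowIndices P)
    {v w w' : Vertex P} (h : Tight A a v w) (h' : Tight A a' v w') : a = a' ∧ w = w' := by
  have hv := v.bounds
  suffices haa : a = a' by
    subst haa
    refine ⟨rfl, Vertex.ext' ?_ (h.1.2.2.1.trans h'.1.2.2.1.symm)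
      (h.1.2.2.2.trans h'.1.2.2.2.symm)⟩
    have h1 := h.1.2.1
    have h2 := h'.1.2.1
    omega
  have hB : ∀ {i w}, Sum.inl (Sum.inl i) ∈ arrowIndices P → Tight A (.inl (.inl i)) v w →
      i ∈ nonMin P ∧ v.level = i ∧ v.row = mult P v.level ∧
        v.pos ≤ tightBound A (prev P i) i := fun {i w} hi ht => by
    have hi' : i ∈ nonMin P := by simpa [arrowIndices] using hi
    obtain ⟨⟨h1, h2⟩, -⟩ := ht.1
    exact ⟨hi', h1, by rw [h1]; exact h2, (tight_beta_iff hA hgap hi' ht.1).1 ht⟩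
  have hC : ∀ {i w}, Sum.inl (Sum.inr i) ∈ arrowIndices P → Tight A (.inl (.inr i)) v w →
      i ∈ nonMin P ∧ v.level = prev P i ∧ v.row = mult P v.level ∧
        prev P i + 1 - v.pos ≤ tightBound A (prev P i) i := fun {i w} hi ht => by
    have hi' : i ∈ nonMin P := by simpa [arrowIndices] using hi
    obtain ⟨⟨h1, h2⟩, -⟩ := ht.1
    exact ⟨hi', h1, by rw [h1]; exact h2, (tight_alpha_iff hA hgap hi' ht.1).1 ht⟩
  have hE : ∀ {i k w}, Sum.inr (Sum.inl ⟨i, k⟩) ∈ arrowIndices P →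
      Tight A (.inr (.inl ⟨i, k⟩)) v w →
      v.level = i ∧ v.row = k ∧ k < mult P v.level := fun {i k w} hi ht => by
    have hi' : i ∈ supp P ∧ 1 ≤ k ∧ k < mult P i := by simpa [arrowIndices] using hi
    obtain ⟨⟨h1, h2⟩, -⟩ := ht.1
    exact ⟨h1, h2, by rw [h1]; exact hi'.2.2⟩
  have hW : ∀ {l w}, Sum.inr (Sum.inr l) ∈ arrowIndices P → Tight A (.inr (.inr l)) v w →
      l - 1 ∉ supp P ∧ v.level = l ∧ v.row = mult P v.level ∧
        IsWide A l ∧ chainCount A l ≤ v.pos ∧ v.pos + chainCount A l ≤ l := fun {l w} hi ht => by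
    have hi' : l ∈ oddMin P := by simpa [arrowIndices] using hi
    obtain ⟨⟨h1, h2⟩, -⟩ := ht.1
    exact ⟨sub_one_notMem_of_mem_oddMin hi', h1, by rw [h1]; exact h2, (tight_w_iff hgap ht.1).1 ht⟩
  have hBC : ∀ {i j w w'}, Sum.inl (Sum.inl i) ∈ arrowIndices P → Tight A (.inl (.inl i)) v w →
      Sum.inl (Sum.inr j) ∈ arrowIndices P → Tight A (.inl (.inr j)) v w' → False := by
    intro i j w w' hi ht hj ht'
    obtain ⟨b1, b2, -, b3⟩ := hB hi ht
    obtain ⟨c1, c2, -, c3⟩ := hC hj ht'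
    have hp := prev_spec c1
    rw [← c2] at c3 hp
    rw [← b2] at b1 b3
    exact not_tight_beta_alpha hA hgap (prev_spec b1).2.1 hp.2.1 hv.1 b3 c3
  have hBW : ∀ {i l w w'}, Sum.inl (Sum.inl i) ∈ arrowIndices P → Tight A (.inl (.inl i)) v w →
      Sum.inr (Sum.inr l) ∈ arrowIndices P → Tight A (.inr (.inr l)) v w' → False := by
    intro i l w w' hi ht hl ht'
    obtain ⟨b1, b2, -, b3⟩ := hB hi ht
    obtain ⟨c1, c2, -, c3, c4, -⟩ := hW hl ht'
    obtain rfl : i = l := b2.symm.trans c2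
    exact not_tight_beta_w hgap (prev_add_one_lt b1 c1) c3 b3 c4
  have hCW : ∀ {i l w w'}, Sum.inl (Sum.inr i) ∈ arrowIndices P → Tight A (.inl (.inr i)) v w →
      Sum.inr (Sum.inr l) ∈ arrowIndices P → Tight A (.inr (.inr l)) v w' → False := by
    intro i l w w' hi ht hl ht'
    obtain ⟨b1, b2, -, b3⟩ := hC hi ht
    obtain ⟨c1, c2, -, c3, -, c4⟩ := hW hl ht'
    rw [← b2, c2] at b3
    exact not_tight_alpha_w hgap c3 b3 c4
  rcases a with (i | i) | (⟨i, k⟩ | l) <;> rcases a' with (i' | i') | (⟨i', k'⟩ | l')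
  · rw [(hB ha h).2.1.symm.trans (hB ha' h').2.1]
  · exact (hBC ha h ha' h').elim
  · have := hB ha h
    have := hE ha' h'
    omega
  · exact (hBW ha h ha' h').elim
  · exact (hBC ha' h' ha h).elim
  · rw [prev_injective (hC ha h).1 (hC ha' h').1 ((hC ha h).2.1.symm.trans (hC ha' h').2.1)]
  · have := hC ha h
    have := hE ha' h'
    omega
  · exact (hCW ha h ha' h').elim
  · have := hE ha h
    have := hB ha' h'
    omega
  · have := hE ha h
    have := hC ha' h'
    omega
  · obtain ⟨h1, h2, -⟩ := hE ha h
    obtain ⟨h3, h4, -⟩ := hE ha' h'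
    rw [h1.symm.trans h3, h2.symm.trans h4]
  · have := hE ha h
    have := hW ha' h'
    omega
  · exact (hBW ha' h' ha h).elim
  · exact (hCW ha' h' ha h).elim
  · have := hW ha h
    have := hE ha' h'
    omega
  · rw [(hW ha h).2.1.symm.trans (hW ha' h').2.1]

end Tight

end Oblak

/-! ### The chains are connected by tight maps -/

namespace Oblak
open Module

variable {K : Type*} [Field K] {n : ℕ} {P Q : n.Partition}

section Chains

variable {A : Finset ℕ} (hA : A ⊆ supp P)
  (hgap : ∀ a ∈ A, ∀ b ∈ A, a < b → a + 2 ≤ b)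

/-- The positions `u` of level `i` that lie on the chains with labels `A`. If neither `i` nor
`i + 1` is a wide label, these are the first and the last `chainCount A i` positions. -/
def OnChain (A : Finset ℕ) (i u : ℕ) : Prop :=
  IsWide A i ∨ IsWide A (i + 1) ∨ u ≤ chainCount A i ∨ i + 1 ≤ u + chainCount A i

theorem card_filter_lt {i : ℕ} (hi : 1 ≤ i) :
    (A.filter fun a => a < i).card = labelCount A (i - 1) := by
  rw [labelCount]
  congr 1
  ext a
  simp only [Finset.mem_filter, and_congr_right_iff]
  omega

/-- If `i` or `i + 1` is a label but not wide, the whole level `i` is covered by the first and the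
last `chainCount A i` positions. -/
theorem mem_uChain_iff (v : Vertex P) : v ∈ uChain P A ↔ OnChain A v.level v.pos := by
  have hv := v.bounds
  obtain ⟨i, hi⟩ : ∃ i, v.level = i + 1 := ⟨v.level - 1, by omega⟩
  have hc : ¬ IsWide A (i + 1 + 1) → chainCount A (i + 1) = labelCount A (i + 1) :=
    fun h => by rw [chainCount, if_neg h, add_zero]
  have hle : i + 1 ∉ A → labelCount A (i + 1) = labelCount A i := labelCount_succ_of_notMem
  have hle' : labelCount A i ≤ labelCount A (i + 1) := labelCount_mono (Nat.le_add_right i 1)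
  simp only [uChain, Finset.mem_filter, Finset.mem_univ, true_and]
  rw [card_filter_lt (by omega), OnChain, hi, Nat.add_sub_cancel]
  by_cases h2 : IsWide A (i + 1 + 1)
  · exact iff_of_true (Or.inl (Or.inr h2.1)) (Or.inr (Or.inl h2))
  by_cases h1 : IsWide A (i + 1)
  · exact iff_of_true (Or.inl (Or.inl h1.1)) (Or.inl h1)
  rw [hc h2]
  by_cases h3 : i + 1 ∈ A
  · have h4 : ¬ 2 * labelCount A (i + 1) ≤ i + 1 := fun h0 => h1 ⟨h3, h0⟩
    refine iff_of_true (Or.inl (Or.inl h3)) (Or.inr (Or.inr ?_))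
    omega
  by_cases h5 : i + 1 + 1 ∈ A
  · have h4 : ¬ 2 * labelCount A (i + 1 + 1) ≤ i + 1 + 1 := fun h0 => h2 ⟨h5, h0⟩
    have h6 := labelCount_succ_of_mem h5
    refine iff_of_true (Or.inl (Or.inr h5)) (Or.inr (Or.inr ?_))
    omega
  · have := hle h3
    simp only [h1, h2, h3, h5, false_or, this]

include hA hgap in
theorem exists_tight_beta {w : Vertex P} (hw : w.row = 1) {j : ℕ} (hj : j ∈ nonMin P)
    (hp : prev P j = w.level) (ht : w.pos ≤ tightBound A w.level j) (hc : OnChain A j w.pos) :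
    ∃ v ∈ uChain P A, ∃ a ∈ arrowIndices P, Tight A a v w := by
  have hs := prev_spec hj
  have hb := w.bounds
  have hm := mult_pos_iff.2 (Finset.mem_filter.1 hj).1
  let v : Vertex P := Vertex.mk w.pos j (mult P j) (by omega)
  have hM : (arrow P (.inl (.inl j))).Maps v w := ⟨⟨rfl, rfl⟩, rfl, hp.symm, hw⟩
  refine ⟨v, (mem_uChain_iff v).2 hc, .inl (.inl j), by simpa [arrowIndices] using hj, ?_⟩
  rw [tight_beta_iff hA hgap hj hM, hp]
  exact ht

include hA hgap in
theorem exists_tight_alpha {w : Vertex P} (hw : w.row = 1) (hj : w.level ∈ nonMin P)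
    (hu : w.level + 1 - w.pos ≤ prev P w.level)
    (ht : w.level + 1 - w.pos ≤ tightBound A (prev P w.level) w.level)
    (hc : OnChain A (prev P w.level) (w.pos + prev P w.level - w.level)) :
    ∃ v ∈ uChain P A, ∃ a ∈ arrowIndices P, Tight A a v w := by
  have hs := prev_spec hj
  have hb := w.bounds
  have hm := mult_pos_iff.2 hs.1
  let v : Vertex P := Vertex.mk (w.pos + prev P w.level - w.level) (prev P w.level)
    (mult P (prev P w.level)) (by omega)
  have hM : (arrow P (.inl (.inr w.level))).Maps v w := by
    refine ⟨⟨rfl, rfl⟩, ?_, rfl, hw⟩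
    change w.pos + prev P w.level = w.pos + prev P w.level - w.level + w.level
    omega
  refine ⟨v, (mem_uChain_iff v).2 hc, .inl (.inr w.level),
    by simpa [arrowIndices] using hj, ?_⟩
  rw [tight_alpha_iff hA hgap hj hM]
  change prev P w.level + 1 - (w.pos + prev P w.level - w.level) ≤ _
  rwa [show prev P w.level + 1 - (w.pos + prev P w.level - w.level) = w.level + 1 - w.pos by omega]

include hgap in
theorem exists_tight_w {w : Vertex P} (hw : w.row = 1) (ho : w.level ∈ oddMin P)
    (hwide : IsWide A w.level) (h1 : chainCount A w.level < w.pos)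
    (h2 : w.pos + chainCount A w.level ≤ w.level + 1) :
    ∃ v ∈ uChain P A, ∃ a ∈ arrowIndices P, Tight A a v w := by
  have hb := w.bounds
  have hc : 1 ≤ chainCount A w.level := by
    obtain ⟨i, hi⟩ : ∃ i, w.level = i + 1 := ⟨w.level - 1, by omega⟩
    have := hwide.1
    rw [hi] at this
    rw [chainCount_of_isWide hgap hwide, hi, labelCount_succ_of_mem this]
    omega
  let v : Vertex P := Vertex.mk (w.pos - 1) w.level (mult P w.level) (by omega)
  have hM : (arrow P (.inr (.inr w.level))).Maps v w := by
    refine ⟨⟨rfl, rfl⟩, ?_, rfl, hw⟩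
    change w.pos = w.pos - 1 + 1
    omega
  refine ⟨v, (mem_uChain_iff v).2 (Or.inl hwide), .inr (.inr w.level),
    by simpa [arrowIndices] using ho, ?_⟩
  rw [tight_w_iff hgap hM]
  refine ⟨hwide, ?_, ?_⟩
  · change _ ≤ w.pos - 1
    omega
  · change w.pos - 1 + _ ≤ _
    omega

include hA hgap in
/-- The ascending part of a chain whose label is less than the level. -/
theorem exists_tight_alpha_of_le_labelCount {w : Vertex P} (hw : w.row = 1)
    (hu : w.level + 1 - w.pos ≤ labelCount A (w.level - 1))
    (hn : ¬ (IsWide A w.level ∧ w.level - 1 ∈ supp P)) :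
    ∃ v ∈ uChain P A, ∃ a ∈ arrowIndices P, Tight A a v w := by
  have hb := w.bounds
  have hpos : ∀ a ∈ A, 1 ≤ a := fun a ha => pos_of_mem_supp (hA ha)
  obtain ⟨b, hb'⟩ := Finset.card_pos.1 (show 0 < (A.filter fun b => b ≤ w.level - 1).card by
    rw [labelCount] at hu
    omega)
  rw [Finset.mem_filter] at hb'
  have hj : w.level ∈ nonMin P := mem_nonMin w.level_mem (hA hb'.1) (by omega)
  have hp := prev_spec hj
  have hle : labelCount A (w.level - 1) ≤ labelCount A (prev P w.level) := by
    refine Finset.card_le_card fun c hc => ?_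
    rw [Finset.mem_filter] at hc ⊢
    exact ⟨hc.1, hp.2.2 c (hA hc.1) (by omega)⟩
  have hle2 : labelCount A (prev P w.level) ≤ chainCount A (prev P w.level) := Nat.le_add_right _ _
  have hc := two_mul_chainCount_le hpos hgap (prev P w.level)
  have ht : tightBound A (prev P w.level) w.level = chainCount A (prev P w.level) := by
    rw [tightBound, if_neg]
    rintro ⟨h1, h2⟩
    refine hn ⟨h1, ?_⟩
    rw [show w.level - 1 = prev P w.level by omega]
    exact hp.1
  refine exists_tight_alpha hA hgap hw hj (by omega) (by omega) (Or.inr (Or.inr (Or.inr ?_)))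
  omega

include hA hgap in
/-- Every vertex on the chains is the target of a tight map from another one, unless it is the
first vertex of a chain, in the first row of the highest level. -/
theorem exists_tight_pred (hodd : ∀ b ∈ A, IsWide A b → b - 1 ∉ supp P → b ∈ oddMin P)
    {w : Vertex P} (hw : w ∈ uChain P A) :
    (w.row = 1 ∧ w.pos ≤ A.card ∧ ∀ k ∈ supp P, k ≤ w.level) ∨
      ∃ v ∈ uChain P A, ∃ a ∈ arrowIndices P, Tight A a v w := by
  have hb := w.bounds
  have hpos : ∀ a ∈ A, 1 ≤ a := fun a ha => pos_of_mem_supp (hA ha)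
  have hl := w.level_mem
  have hc2 := two_mul_chainCount_le hpos hgap w.level
  have hon := (mem_uChain_iff w).1 hw
  by_cases hrow : w.row = 1
  swap
  · right
    let v : Vertex P := Vertex.mk w.pos w.level (w.row - 1) (by omega)
    have hM : (arrow P (.inr (.inl ⟨w.level, w.row - 1⟩))).Maps v w :=
      ⟨⟨rfl, rfl⟩, rfl, rfl, by change w.row = w.row - 1 + 1; omega⟩
    refine ⟨v, (mem_uChain_iff v).2 hon, _, ?_, tight_e hM⟩
    simp only [arrowIndices, Finset.inr_mem_disjSum, Finset.inl_mem_disjSum, Finset.mem_sigma,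
      Finset.mem_Ico]
    exact ⟨hl, by omega, by omega⟩
  have hle : labelCount A w.level ≤ A.card := Finset.card_filter_le _ _
  have hlm : w.level ∉ A → labelCount A w.level = labelCount A (w.level - 1) := by
    obtain ⟨i, hi⟩ : ∃ i, w.level = i + 1 := ⟨w.level - 1, by omega⟩
    rw [hi]
    exact labelCount_succ_of_notMem
  have hlm' : w.level ∈ A → labelCount A w.level = labelCount A (w.level - 1) + 1 := by
    obtain ⟨i, hi⟩ : ∃ i, w.level = i + 1 := ⟨w.level - 1, by omega⟩
    rw [hi]
    exact labelCount_succ_of_mem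
  by_cases h1 : w.pos ≤ chainCount A w.level
  · -- descending part of a chain
    by_cases htop : ∀ k ∈ supp P, k ≤ w.level
    · refine Or.inl ⟨hrow, h1.trans ?_, htop⟩
      rw [chainCount]
      split_ifs with h2
      · rw [← labelCount_succ_of_mem h2.1]
        exact Finset.card_filter_le _ _
      · exact hle
    · right
      push Not at htop
      obtain ⟨k, hk, hk'⟩ := htop
      obtain ⟨j, hj, hjp⟩ := exists_prev_eq hl hk hk'
      have hjs := prev_spec hj
      have hmono := chainCount_mono hgap (show w.level ≤ j by omega)
      refine exists_tight_beta hA hgap hrow hj hjp ?_ (Or.inr (Or.inr (Or.inl (h1.trans hmono))))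
      rw [tightBound]
      split_ifs with h2
      · obtain ⟨h2, rfl⟩ := h2
        have h3 := chainCount_succ_of_isWide hgap h2
        have h4 := chainCount_of_isWide hgap h2
        have h5 := h2.2
        omega
      · exact h1
  right
  by_cases h2 : IsWide A w.level
  · have h3 := chainCount_of_isWide hgap h2
    have h4 := hlm' h2.1
    by_cases h5 : w.level - 1 ∈ supp P
    · have h6 := pos_of_mem_supp h5
      have hj : w.level ∈ nonMin P := mem_nonMin hl h5 (by omega)
      have hp : prev P w.level = w.level - 1 := prev_eq hj h5 (by omega) fun k _ hk => by omega
      refine exists_tight_alpha hA hgap hrow hj (by omega) ?_ (Or.inr (Or.inl ?_))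
      · rw [tightBound, if_pos ⟨h2, by omega⟩]
        omega
      · rw [hp, Nat.sub_add_cancel (by omega)]
        exact h2
    · by_cases h6 : w.pos + chainCount A w.level ≤ w.level + 1
      · exact exists_tight_w hgap hrow (hodd _ h2.1 h2 h5) h2 (by omega) h6
      · exact exists_tight_alpha_of_le_labelCount hA hgap hrow (by omega) fun h => h5 h.2
  by_cases h3 : IsWide A (w.level + 1)
  · have h4 : w.level ∉ A := fun h0 => by
      have := hgap _ h0 _ h3.1 (by omega)
      omega
    have h5 := chainCount_succ_of_isWide hgap h3
    have h7 : chainCount A w.level = labelCount A w.level + 1 := by rw [chainCount, if_pos h3]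
    have h8 := hlm h4
    by_cases h6 : w.pos + chainCount A w.level ≤ w.level + 1
    · have hj : w.level + 1 ∈ nonMin P := mem_nonMin (hA h3.1) hl (by omega)
      have hp : prev P (w.level + 1) = w.level := prev_eq hj hl (by omega) fun k _ hk => by omega
      refine exists_tight_beta hA hgap hrow hj hp ?_ (Or.inl h3)
      rw [tightBound, if_pos ⟨h3, rfl⟩]
      omega
    · exact exists_tight_alpha_of_le_labelCount hA hgap hrow (by omega) fun h => h2 h.1
  · have h4 : chainCount A w.level = labelCount A w.level := by rw [chainCount, if_neg h3, add_zero]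
    have h5 : w.level + 1 ≤ w.pos + chainCount A w.level := by
      rcases hon with h | h | h | h
      · exact absurd h h2
      · exact absurd h h3
      · exact absurd h h1
      · exact h
    refine exists_tight_alpha_of_le_labelCount hA hgap hrow ?_ fun h => h2 h.1
    by_cases h6 : w.level ∈ A
    · have h7 : ¬ 2 * labelCount A w.level ≤ w.level := fun h0 => h2 ⟨h6, h0⟩
      have := hlm' h6
      omega
    · have := hlm h6
      omega

end Chains

theorem mem_labels {s : ℕ} {A : Finset ℕ} : A ∈ labels P s ↔
    (A ⊆ supp P ∧ A.card = s) ∧ ∀ a ∈ A, ∀ b ∈ A, a < b → a + 2 ≤ b := by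
  rw [labels, Finset.mem_filter, Finset.mem_powersetCard]

/-- If the label `b` starts a run of consecutive parts of even length, then shifting the labels
`b, b + 2, b + 4, …` up by one gives a larger set of labels, whose chains are no smaller. -/
theorem exists_shifted_labels {s : ℕ} {A : Finset ℕ} (hAl : A ∈ labels P s) {b : ℕ} (hb : b ∈ A)
    (hb1 : b - 1 ∉ supp P) (hbo : b ∉ oddMin P) :
    ∃ A' ∈ labels P s, uChain P A ⊆ uChain P A' ∧ ∑ a ∈ A, a < ∑ a ∈ A', a := by
  obtain ⟨⟨hA, hcard⟩, hgap⟩ := mem_labels.1 hAl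
  -- the end `e` of the run
  obtain ⟨e, he, hbe, hrun, he1⟩ : ∃ e ∈ supp P, b ≤ e ∧ Finset.Icc b e ⊆ supp P ∧
      e + 1 ∉ supp P := by
    have hex : ∃ d, b + d + 1 ∉ supp P := ⟨n, fun h => by
      have := le_of_mem_supp h
      omega⟩
    classical
    have hall : ∀ d ≤ Nat.find hex, b + d ∈ supp P := by
      intro d hd
      rcases d with _ | d
      · exact hA hb
      · by_contra h0
        exact Nat.find_min hex (show d < _ by omega) h0
    refine ⟨b + Nat.find hex, hall _ le_rfl, by omega, fun x hx => ?_, Nat.find_spec hex⟩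
    rw [Finset.mem_Icc] at hx
    have := hall (x - b) (by omega)
    rwa [show b + (x - b) = x by omega] at this
  have hodd : ¬ Odd (Finset.Icc b e).card := fun h0 =>
    hbo (Finset.mem_filter.2 ⟨hA hb, e, he, hrun, hb1, he1, h0⟩)
  rw [Nat.card_Icc, Nat.not_odd_iff_even] at hodd
  obtain ⟨r, hr⟩ := hodd
  -- the last label `b + 2 * m` to be shifted
  obtain ⟨m, hm, hm1⟩ : ∃ m, (∀ j ≤ m, b + 2 * j ∈ A) ∧ b + 2 * m + 2 ∉ A := by
    have hex : ∃ m, b + 2 * m + 2 ∉ A := ⟨n, fun h => by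
      have := le_of_mem_supp (hA h)
      omega⟩
    classical
    refine ⟨Nat.find hex, fun j hj => ?_, Nat.find_spec hex⟩
    rcases j with _ | j
    · exact hb
    · by_contra h0
      exact Nat.find_min hex (show j < _ by omega) h0
  have hme : ∀ j ≤ m, b + 2 * j + 1 ≤ e := by
    intro j
    induction j with
    | zero => intro _; omega
    | succ j ih =>
      intro hj
      have h1 := ih (by omega)
      have h2 := hA (hm (j + 1) hj)
      have h3 : b + 2 * (j + 1) ≠ e + 1 := fun h0 => he1 (h0 ▸ h2)
      omega
  have hmm := hme m le_rfl
  let σ : ℕ → ℕ := fun a => if b ≤ a ∧ a ≤ b + 2 * m then a + 1 else a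
  have hσ1 : ∀ a, b ≤ a ∧ a ≤ b + 2 * m → σ a = a + 1 := fun a h => if_pos h
  have hσ2 : ∀ a, ¬ (b ≤ a ∧ a ≤ b + 2 * m) → σ a = a := fun a h => if_neg h
  have hσgap : ∀ a ∈ A, ∀ a' ∈ A, a < a' → σ a + 2 ≤ σ a' := by
    intro a ha a' ha' hlt
    have h1 := hgap a ha a' ha' hlt
    by_cases h2 : b ≤ a ∧ a ≤ b + 2 * m
    · rw [hσ1 a h2]
      by_cases h3 : b ≤ a' ∧ a' ≤ b + 2 * m
      · rw [hσ1 a' h3]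
        omega
      · rw [hσ2 a' h3]
        have h4 : a' ≠ b + 2 * m + 2 := fun h0 => hm1 (h0 ▸ ha')
        by_cases h5 : a = b + 2 * m
        · omega
        · have := hgap a ha _ (hm m le_rfl) (by omega)
          omega
    · rw [hσ2 a h2]
      have : a' ≤ σ a' := by
        by_cases h3 : b ≤ a' ∧ a' ≤ b + 2 * m
        · rw [hσ1 a' h3]; omega
        · rw [hσ2 a' h3]
      omega
  have hσinj : Set.InjOn σ A := by
    intro a ha a' ha' h
    rcases lt_trichotomy a a' with h1 | h1 | h1
    · have := hσgap a ha a' ha' h1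
      omega
    · exact h1
    · have := hσgap a' ha' a ha h1
      omega
  refine ⟨A.image σ, mem_labels.2 ⟨⟨?_, ?_⟩, ?_⟩, ?_, ?_⟩
  · intro x hx
    obtain ⟨a, ha, rfl⟩ := Finset.mem_image.1 hx
    by_cases h2 : b ≤ a ∧ a ≤ b + 2 * m
    · rw [hσ1 a h2]
      exact hrun (Finset.mem_Icc.2 ⟨by omega, by omega⟩)
    · rw [hσ2 a h2]
      exact hA ha
  · rw [Finset.card_image_of_injOn hσinj, hcard]
  · intro x hx y hy hxy
    obtain ⟨a, ha, rfl⟩ := Finset.mem_image.1 hx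
    obtain ⟨a', ha', rfl⟩ := Finset.mem_image.1 hy
    rcases lt_trichotomy a a' with h1 | h1 | h1
    · exact hσgap a ha a' ha' h1
    · subst h1
      omega
    · have := hσgap a' ha' a ha h1
      omega
  · intro v hv
    simp only [uChain, Finset.mem_filter, Finset.mem_univ, true_and] at hv ⊢
    have hfull : b ≤ v.level ∧ v.level ≤ b + 2 * m + 1 →
        v.level ∈ A.image σ ∨ v.level + 1 ∈ A.image σ := by
      rintro ⟨h1, h2⟩
      rcases Nat.even_or_odd' (v.level - b) with ⟨j, hj | hj⟩
      · right
        refine Finset.mem_image.2 ⟨b + 2 * j, hm j (by omega), ?_⟩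
        rw [hσ1 _ (by omega)]
        omega
      · left
        refine Finset.mem_image.2 ⟨b + 2 * j, hm j (by omega), ?_⟩
        rw [hσ1 _ (by omega)]
        omega
    by_cases h0 : b ≤ v.level ∧ v.level ≤ b + 2 * m + 1
    · exact Or.inl (hfull h0)
    have hcount : (A.filter fun a => a < v.level).card ≤
        ((A.image σ).filter fun a => a < v.level).card := by
      refine Finset.card_le_card_of_injOn σ ?_ (hσinj.mono (Finset.filter_subset _ _))
      intro a ha
      rw [Finset.mem_coe, Finset.mem_filter] at ha ⊢
      refine ⟨Finset.mem_image_of_mem σ ha.1, ?_⟩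
      by_cases h2 : b ≤ a ∧ a ≤ b + 2 * m
      · rw [hσ1 a h2]
        omega
      · rw [hσ2 a h2]
        exact ha.2
    rcases hv with (h | h) | h
    · left; left
      refine Finset.mem_image.2 ⟨_, h, hσ2 _ (by omega)⟩
    · left; right
      refine Finset.mem_image.2 ⟨_, h, hσ2 _ ?_⟩
      rintro ⟨h1, h2⟩
      refine hb1 ?_
      rw [show b - 1 = v.level by omega]
      exact v.level_mem
    · right
      omega
  · rw [Finset.sum_image hσinj]
    refine Finset.sum_lt_sum (fun a _ => ?_) ⟨b, hb, ?_⟩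
    · by_cases h2 : b ≤ a ∧ a ≤ b + 2 * m
      · rw [hσ1 a h2]; omega
      · rw [hσ2 a h2]
    · rw [hσ1 b (by omega)]
      omega

/-- Among the labels whose chains have the maximal size, those with the largest sum cannot be
shifted. -/
theorem exists_max_labels {s : ℕ} (hne : (labels P s).Nonempty) :
    ∃ A ∈ labels P s, (uChain P A).card = uMax P s ∧
      ∀ b ∈ A, b - 1 ∉ supp P → b ∈ oddMin P := by
  obtain ⟨A₀, hA₀, hmax₀⟩ := Finset.exists_mem_eq_sup _ hne fun A => (uChain P A).card
  obtain ⟨A, hA, hmax⟩ := Finset.exists_max_image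
    ((labels P s).filter fun A => (uChain P A).card = uMax P s) (fun A => ∑ a ∈ A, a)
    ⟨A₀, Finset.mem_filter.2 ⟨hA₀, hmax₀.symm⟩⟩
  rw [Finset.mem_filter] at hA
  refine ⟨A, hA.1, hA.2, fun b hb hb1 => ?_⟩
  by_contra hbo
  obtain ⟨A', hA', hsub, hlt⟩ := exists_shifted_labels hA.1 hb hb1 hbo
  have h1 : (uChain P A').card ≤ uMax P s :=
    Finset.le_sup (f := fun A => (uChain P A).card) hA'
  have h2 := Finset.card_le_card hsub
  have h3 := hmax A' (Finset.mem_filter.2 ⟨hA', by omega⟩)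
  omega

end Oblak

/-! ### Degeneration to the tight maps -/

namespace Oblak
open Module

variable {K : Type*} [Field K] {n : ℕ} {P Q : n.Partition}

section Degeneration

open Polynomial

variable {A : Finset ℕ} (hA : A ⊆ supp P)
  (hgap : ∀ a ∈ A, ∀ b ∈ A, a < b → a + 2 ≤ b)

/-- The sum of the elementary maps with coefficients `X ^ weight`. -/
noncomputable def weightedSum (K : Type*) [Field K] (P : n.Partition) (A : Finset ℕ) :
    Matrix (Vertex P) (Vertex P) K[X] := arrowSum P fun a => X ^ weight P A a

open Classical in
/-- The conjugate of `weightedSum` by the diagonal matrix of the `X ^ potential`. -/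
noncomputable def rescaledSum (K : Type*) [Field K] (P : n.Partition) (A : Finset ℕ) :
    Matrix (Vertex P) (Vertex P) K[X] :=
  Matrix.of fun w v => ∑ a ∈ arrowIndices P,
    if (arrow P a).Maps v w then X ^ (v.potential A + weight P A a - w.potential A) else 0

include hgap in
theorem diagonal_mul_rescaledSum :
    Matrix.diagonal (fun v : Vertex P => (X : K[X]) ^ v.potential A) * rescaledSum K P A =
      weightedSum K P A * Matrix.diagonal fun v : Vertex P => (X : K[X]) ^ v.potential A := by
  ext1 w v
  rw [Matrix.diagonal_mul, Matrix.mul_diagonal, weightedSum, arrowSum, Matrix.sum_apply,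
    rescaledSum, Matrix.of_apply, Finset.mul_sum, Finset.sum_mul]
  refine Finset.sum_congr rfl fun a ha => ?_
  rw [Matrix.smul_apply, arrowMatrix, Matrix.of_apply, smul_eq_mul]
  by_cases h : (arrow P a).Maps v w
  · have := potential_le_of_maps hgap ha h
    rw [if_pos h, if_pos h, mul_one, ← pow_add, ← pow_add]
    congr 1
    omega
  · rw [if_neg h, if_neg h, mul_zero, mul_zero, zero_mul]

include hgap in
theorem diagonal_mul_rescaledSum_pow (k : ℕ) :
    Matrix.diagonal (fun v : Vertex P => (X : K[X]) ^ v.potential A) * rescaledSum K P A ^ k =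
      weightedSum K P A ^ k * Matrix.diagonal fun v : Vertex P => (X : K[X]) ^ v.potential A := by
  induction k with
  | zero => rw [pow_zero, pow_zero, Matrix.mul_one, Matrix.one_mul]
  | succ k ih =>
    rw [pow_succ, ← Matrix.mul_assoc, ih, Matrix.mul_assoc, diagonal_mul_rescaledSum hgap,
      ← Matrix.mul_assoc, ← pow_succ]

/-- The limit of `rescaledSum` for `X = 0`; only the tight maps survive. -/
noncomputable def tightMatrix (K : Type*) [Field K] (P : n.Partition) (A : Finset ℕ) :
    Matrix (Vertex P) (Vertex P) K := (evalRingHom 0).mapMatrix (rescaledSum K P A)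

include hA hgap in
theorem tightMatrix_mulVec_single {a : ArrowIndex} (ha : a ∈ arrowIndices P) {v w : Vertex P}
    (h : Tight A a v w) :
    (tightMatrix K P A).mulVec (Pi.single v 1) = Pi.single w 1 := by
  classical
  ext w'
  rw [Matrix.mulVec_single_one, Matrix.col_apply, tightMatrix, RingHom.mapMatrix_apply,
    Matrix.map_apply, rescaledSum, Matrix.of_apply, map_sum, Pi.single_apply]
  have hzero : ∀ a' ∈ arrowIndices P, ¬ (a' = a ∧ w' = w) → evalRingHom (0 : K)
      (if (arrow P a').Maps v w' then
        X ^ (v.potential A + weight P A a' - w'.potential A) else 0) = 0 := by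
    intro a' ha' hne
    by_cases hM : (arrow P a').Maps v w'
    · rw [if_pos hM, map_pow, coe_evalRingHom, eval_X, zero_pow]
      intro h0
      have h1 := potential_le_of_maps hgap ha' hM
      obtain ⟨h2, h3⟩ := Tight.unique hA hgap ha' ha ⟨hM, by omega⟩ h
      exact hne ⟨h2, h3⟩
    · rw [if_neg hM, map_zero]
  split_ifs with hw
  · subst hw
    rw [Finset.sum_eq_single_of_mem a ha fun a' ha' hne => hzero a' ha' fun h0 => hne h0.1,
      if_pos h.1, h.2, Nat.sub_self, pow_zero, map_one]
  · exact Finset.sum_eq_zero fun a' ha' => hzero a' ha' fun h0 => hw h0.2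

/-- The first vertices of the chains. -/
def IsStart (s : ℕ) (v : Vertex P) : Prop :=
  v.row = 1 ∧ v.pos ≤ s ∧ ∀ k ∈ supp P, k ≤ v.level

include hA hgap in
/-- Following tight maps backwards, which lowers the height, one arrives at the start of a
chain. -/
theorem exists_start (hodd : ∀ b ∈ A, IsWide A b → b - 1 ∉ supp P → b ∈ oddMin P)
    {w : Vertex P} (hw : w ∈ uChain P A) :
    ∃ v : Vertex P, IsStart A.card v ∧ ∃ k : ℕ,
      ((tightMatrix K P A) ^ k).mulVec (Pi.single v 1) = Pi.single w 1 := by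
  obtain ⟨m, hm⟩ : ∃ m, w.height = m := ⟨_, rfl⟩
  induction m using Nat.strong_induction_on generalizing w with
  | _ m ih =>
    rcases exists_tight_pred hA hgap hodd hw with h | ⟨x, hx, a, ha, ht⟩
    · exact ⟨w, h, 0, by rw [pow_zero, Matrix.one_mulVec]⟩
    · obtain ⟨v, hv, k, hk⟩ := ih _ (by rw [← hm]; exact height_lt_of_maps ha ht.1) hx rfl
      refine ⟨v, hv, k + 1, ?_⟩
      rw [pow_succ', ← Matrix.mulVec_mulVec, hk, tightMatrix_mulVec_single hA hgap ha ht]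

include hA hgap in
/-- By conjugation with powers of `X`, the minor differs from that of `rescaledSum` by a power of
`X`, and the latter is `1` for `X = 0`. -/
theorem exists_powMinor (hodd : ∀ b ∈ A, IsWide A b → b - 1 ∉ supp P → b ∈ oddMin P) :
    ∃ (k : uChain P A → ℕ) (c : uChain P A → Vertex P), (∀ w, IsStart A.card (c w)) ∧
      MvPolynomial.aeval (fun p : Vertex P × Vertex P => weightedSum K P A p.1 p.2)
        (powMinor K k Subtype.val c) ≠ 0 := by
  classical
  choose c hc k hk using fun w : uChain P A => exists_start (K := K) hA hgap hodd w.2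
  refine ⟨k, c, hc, ?_⟩
  rw [aeval_powMinor]
  set M := Matrix.of fun i j : uChain P A => (weightedSum K P A ^ k j) i.1 (c j) with hM
  let N := Matrix.of fun i j : uChain P A => (rescaledSum K P A ^ k j) i.1 (c j)
  have h1 : Matrix.diagonal (fun i : uChain P A => (X : K[X]) ^ i.1.potential A) * N =
      M * Matrix.diagonal fun j : uChain P A => (X : K[X]) ^ (c j).potential A := by
    ext1 i j
    have h := congrFun (congrFun (diagonal_mul_rescaledSum_pow (K := K) (P := P) hgap (k j)) i.1)
      (c j)
    rw [Matrix.diagonal_mul, Matrix.mul_diagonal] at h ⊢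
    exact h
  have h2 : (evalRingHom (0 : K)).mapMatrix N = 1 := by
    ext i j
    have h := congrFun (hk j) i.1
    rw [Matrix.mulVec_single_one, Matrix.col_apply, tightMatrix, ← map_pow, Pi.single_apply] at h
    rw [Matrix.one_apply]
    refine Eq.trans h (if_congr ?_ rfl rfl)
    exact Subtype.ext_iff.symm
  have h3 : N.det ≠ 0 := by
    intro h0
    have := RingHom.map_det (evalRingHom (0 : K)) N
    rw [h0, map_zero, h2, Matrix.det_one] at this
    exact zero_ne_one this
  intro h0
  have h4 := congrArg Matrix.det h1
  rw [Matrix.det_mul, Matrix.det_mul, h0, zero_mul, Matrix.det_diagonal] at h4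
  refine mul_ne_zero (Finset.prod_ne_zero_iff.2 fun i _ => pow_ne_zero _ X_ne_zero) h3 h4

end Degeneration

theorem map_arrowSum_apply {R S : Type*} [CommRing R] [CommRing S] (φ : R →+* S)
    (x : ArrowIndex → R) (w v : Vertex P) :
    φ (arrowSum P x w v) = arrowSum P (fun a => φ (x a)) w v := by
  rw [arrowSum, arrowSum, Matrix.sum_apply, Matrix.sum_apply, map_sum]
  refine Finset.sum_congr rfl fun a _ => ?_
  rw [Matrix.smul_apply, Matrix.smul_apply, smul_eq_mul, smul_eq_mul, map_mul, arrowMatrix,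
    arrowMatrix, Matrix.of_apply, Matrix.of_apply]
  split_ifs
  · rw [map_one]
  · rw [map_zero]

theorem partSeq_nonneg (Q : n.Partition) (j : ℕ) : 0 ≤ partSeq Q j := Nat.cast_nonneg _

/-- A polynomial in the matrix entries, not vanishing identically on adequate matrices, whose
non-vanishing bounds the first parts of the Jordan type from below. -/
theorem exists_uMax_polynomial (K : Type*) [Field K] (P : n.Partition) (s : ℕ) :
    ∃ f : MvPolynomial (Vertex P × Vertex P) K,
      (∀ (B : Matrix (Vertex P) (Vertex P) K) (Q : n.Partition), HasJordanType B Q →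
        evalAt f B ≠ 0 → (uMax P s : ℤ) ≤ ∑ j ∈ Finset.range s, partSeq Q j) ∧
      MvPolynomial.aeval (fun p : Vertex P × Vertex P =>
        arrowSum P (MvPolynomial.X : ArrowIndex → MvPolynomial ArrowIndex K) p.1 p.2) f ≠ 0 := by
  classical
  by_cases hne : (labels P s).Nonempty
  swap
  · refine ⟨1, fun B Q _ _ => ?_, by rw [map_one]; exact one_ne_zero⟩
    rw [uMax, Finset.not_nonempty_iff_eq_empty.1 hne, Finset.sup_empty]
    exact Finset.sum_nonneg fun j _ => partSeq_nonneg Q j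
  obtain ⟨A, hAl, hcard, hodd⟩ := exists_max_labels hne
  obtain ⟨⟨hA, hs⟩, hgap⟩ := mem_labels.1 hAl
  obtain ⟨k, c, hc, hf⟩ := exists_powMinor (K := K) hA hgap fun b hb _ => hodd b hb
  refine ⟨powMinor K k Subtype.val c, fun B Q hQ hB => ?_, fun h0 => hf ?_⟩
  · rw [evalAt_powMinor] at hB
    let top : ℕ := (supp P).sup id
    have htop : ∀ w, (c w).level = top := fun w =>
      le_antisymm (Finset.le_sup (f := id) (c w).level_mem)
        (Finset.sup_le fun k hk => (hc w).2.2 k hk)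
    let v : Fin s → Vertex P → K := fun j x =>
      if x.pos = j + 1 ∧ x.level = top ∧ x.row = 1 then 1 else 0
    have hb : ∀ w, (c w).pos - 1 < s := fun w => by
      have := (c w).bounds
      have := (hc w).2.1
      omega
    have hv : ∀ w, v ⟨(c w).pos - 1, hb w⟩ = Pi.single (c w) 1 := by
      intro w
      have hbw := (c w).bounds
      ext x
      rw [Pi.single_apply]
      refine if_congr ⟨fun h => ?_, fun h => ?_⟩ rfl rfl
      · refine Vertex.ext' ?_ (h.2.1.trans (htop w).symm) (h.2.2.trans (hc w).1.symm)
        have := h.1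
        simp only at this
        omega
      · subst h
        exact ⟨by simp only; omega, htop w, (hc w).1⟩
    have h := card_le_sum_partSeq hQ v k (fun w => ⟨(c w).pos - 1, hb w⟩) (by
      have hli := Matrix.linearIndependent_cols_iff_isUnit.2
        ((Matrix.isUnit_iff_isUnit_det _).2 (Ne.isUnit hB))
      refine LinearIndependent.of_comp (LinearMap.funLeft K K (Subtype.val : uChain P A → Vertex P)) ?_
      convert! hli using 1
      ext w x
      rw [Function.comp_apply, hv, Matrix.mulVec_single_one]
      rfl)
    rwa [Fintype.card_coe, hcard] at h
  · have h1 := congrArg (MvPolynomial.aeval (R := K) fun a =>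
      (Polynomial.X : Polynomial K) ^ weight P A a) h0
    rw [map_zero, MvPolynomial.comp_aeval_apply] at h1
    rw [← h1]
    congr 2
    funext p
    exact ((map_arrowSum_apply (MvPolynomial.aeval (R := K) fun a =>
      (Polynomial.X : Polynomial K) ^ weight P A a).toRingHom _ _ _).trans
        (by simp [weightedSum])).symm

/-! ### Dominance and adequate matrices -/

theorem uMax_zero : uMax P 0 = 0 := by
  rw [uMax, ← Nat.le_zero]
  refine Finset.sup_le fun A hA => ?_
  obtain ⟨⟨-, h0⟩, -⟩ := mem_labels.1 hA
  obtain rfl := Finset.card_eq_zero.1 h0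
  rw [Nat.le_zero, Finset.card_eq_zero, uChain, Finset.filter_eq_empty_iff]
  intro v _
  have := v.bounds
  rintro ((h | h) | (h | h))
  · exact Finset.notMem_empty _ h
  · exact Finset.notMem_empty _ h
  · rw [Finset.filter_empty, Finset.card_empty] at h
    omega
  · rw [Finset.filter_empty, Finset.card_empty] at h
    omega

theorem dominates_lambdaU (h : ∀ s, (uMax P s : ℤ) ≤ ∑ j ∈ Finset.range s, partSeq Q j) :
    Dominates (partSeq Q) (lambdaU P) := by
  intro i
  have key : ∀ i, ∑ j ∈ Finset.range i, lambdaU P j = uMax P (min i (rNum P)) := by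
    intro i
    induction i with
    | zero => rw [Finset.sum_range_zero, Nat.zero_min, uMax_zero, Nat.cast_zero]
    | succ i ih =>
      rw [Finset.sum_range_succ, ih, lambdaU]
      split_ifs with hi
      · rw [min_eq_left hi.le, min_eq_left (Nat.succ_le_of_lt hi)]
        ring
      · rw [min_eq_right (not_lt.1 hi), min_eq_right (by omega), add_zero]
  rw [key]
  refine (h _).trans ?_
  exact Finset.sum_le_sum_of_subset_of_nonneg (Finset.range_mono (min_le_left _ _))
    fun j _ _ => partSeq_nonneg Q j

/-- A product of non-zero polynomials over an infinite field does not vanish at some point; the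
coefficients themselves are among the factors, so the matrix at this point is adequate. -/
theorem exists_adequate_evalAt_ne_zero [Infinite K]
    (f : ℕ → MvPolynomial (Vertex P × Vertex P) K)
    (hf : ∀ s, MvPolynomial.aeval (fun p : Vertex P × Vertex P =>
        arrowSum P (MvPolynomial.X : ArrowIndex → MvPolynomial ArrowIndex K) p.1 p.2) (f s) ≠ 0)
    (N : ℕ) :
    ∃ B : Matrix (Vertex P) (Vertex P) K, IsAdequate B ∧ ∀ s ≤ N, evalAt (f s) B ≠ 0 := by
  classical
  let g : ℕ → MvPolynomial ArrowIndex K := fun s =>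
    MvPolynomial.aeval (fun p : Vertex P × Vertex P => arrowSum P MvPolynomial.X p.1 p.2) (f s)
  have hg : ∀ s x, MvPolynomial.eval x (g s) = evalAt (f s) (arrowSum P x) := by
    intro s x
    have h := MvPolynomial.comp_aeval_apply (R := K) (f := fun p : Vertex P × Vertex P =>
      arrowSum P (MvPolynomial.X : ArrowIndex → MvPolynomial ArrowIndex K) p.1 p.2)
      (MvPolynomial.aeval (R := K) x) (f s)
    rw [MvPolynomial.aeval_eq_eval] at h
    refine h.trans ?_
    have hx : (fun p : Vertex P × Vertex P => MvPolynomial.eval x (arrowSum P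
        (MvPolynomial.X : ArrowIndex → MvPolynomial ArrowIndex K) p.1 p.2)) =
        fun p => arrowSum P x p.1 p.2 := by
      funext p
      refine (map_arrowSum_apply (MvPolynomial.eval x) _ _ _).trans ?_
      simp
    rw [hx, MvPolynomial.aeval_eq_eval]
    rfl
  have hne : (∏ s ∈ Finset.range (N + 1), g s) *
      ∏ a ∈ arrowIndices P, (MvPolynomial.X a : MvPolynomial ArrowIndex K) ≠ 0 :=
    mul_ne_zero (Finset.prod_ne_zero_iff.2 fun s _ => hf s)
      (Finset.prod_ne_zero_iff.2 fun a _ => MvPolynomial.X_ne_zero a)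
  obtain ⟨x, hx⟩ : ∃ x, MvPolynomial.eval x ((∏ s ∈ Finset.range (N + 1), g s) *
      ∏ a ∈ arrowIndices P, (MvPolynomial.X a : MvPolynomial ArrowIndex K)) ≠ 0 := by
    by_contra! h0
    exact hne (MvPolynomial.funext fun x => by rw [h0, map_zero])
  rw [map_mul, map_prod, map_prod] at hx
  refine ⟨arrowSum P x, arrowSum_isAdequate fun a ha => ?_, fun s hs => ?_⟩
  · have := (Finset.prod_ne_zero_iff.1 (right_ne_zero_of_mul hx)) a ha
    rwa [MvPolynomial.eval_X] at this
  · rw [← hg]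
    exact (Finset.prod_ne_zero_iff.1 (left_ne_zero_of_mul hx)) s (Finset.mem_range.2 (by omega))

theorem uMax_eq_zero_of_lt {s : ℕ} (hs : n < s) : uMax P s = 0 := by
  have : labels P s = ∅ := by
    rw [Finset.eq_empty_iff_forall_notMem]
    intro A hA
    obtain ⟨⟨h1, h2⟩, -⟩ := mem_labels.1 hA
    have h3 : A ⊆ Finset.Icc 1 n := fun a ha =>
      Finset.mem_Icc.2 ⟨pos_of_mem_supp (h1 ha), le_of_mem_supp (h1 ha)⟩
    have h4 := Finset.card_le_card h3
    rw [Nat.card_Icc] at h4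
    omega
  rw [uMax, this]
  rfl

end Oblak

theorem theorem3p9 {K : Type*} [Field K] [Infinite K] {n : ℕ} (P : n.Partition) :
    ((∃! Q : n.Partition, Oblak.IsGenericJordanType K P Q) ∧
      ∀ Q : n.Partition, Oblak.IsGenericJordanType K P Q →
        Oblak.Dominates (Oblak.partSeq Q) (Oblak.lambdaU P)) ∧
    ∃ A : Matrix (Oblak.Vertex P) (Oblak.Vertex P) K,
      A ∈ Oblak.upperCommutator K P ∧ Oblak.IsAdequate A ∧
        ∃ Q : n.Partition, Oblak.HasJordanType A Q ∧
          Oblak.Dominates (Oblak.partSeq Q) (Oblak.lambdaU P) := by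
  choose f hf hne using Oblak.exists_uMax_polynomial K P
  obtain ⟨B, hB, hBf⟩ := Oblak.exists_adequate_evalAt_ne_zero f hne n
  have hBnil := Oblak.upperCommutator_subset hB.1
  have hdom : ∀ Q : n.Partition, (∀ s ≤ n, ∃ C, Oblak.HasJordanType C Q ∧
      Oblak.evalAt (f s) C ≠ 0) → Oblak.Dominates (Oblak.partSeq Q) (Oblak.lambdaU P) := by
    intro Q hQ
    refine Oblak.dominates_lambdaU fun s => ?_
    rcases Nat.lt_or_ge n s with hs | hs
    · rw [Oblak.uMax_eq_zero_of_lt hs, Nat.cast_zero]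
      exact Finset.sum_nonneg fun j _ => Oblak.partSeq_nonneg Q j
    · obtain ⟨C, hC, hCf⟩ := hQ s hs
      exact hf s C Q hC hCf
  refine ⟨⟨?_, fun Q hQ => hdom Q fun s hs => ?_⟩, B, hB.1, hB, ?_⟩
  · obtain ⟨Q, hQ⟩ := Oblak.exists_isGenericJordanType (K := K) P
    exact ⟨Q, hQ, fun Q' hQ' => hQ'.unique hQ⟩
  · obtain ⟨D, hD, hDQ⟩ := hQ
    by_contra! h0
    exact hBf s hs (Oblak.evalAt_eq_zero_of_dense hD (fun C hC => h0 C (hDQ C hC)) hBnil)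
  · obtain ⟨Q, hQ⟩ := Oblak.exists_hasJordanType hBnil.2
    exact ⟨Q, hQ, hdom Q fun s hs => ⟨B, hQ, hBf s hs⟩⟩
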